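/- Let $k$ be a field of characteristic $0$, $\lambda\in k$, and let $(A,\mu,T)$ be a Rota–Baxter algebra of weight $\lambda$: an associative (not necessarily unital) $k$-algebra with product $\mu(a\otimes b)=ab$ and a linear map $T:A\to A$ such that $T(a)T(b)=T\big(aT(b)+T(a)b+\lambda ab\big)$. Gradings are homological, $A$ is in degree $0$, $s$ is the suspension, and the Koszul sign rule is used. Put $$\mathfrak C_{RBA}(A)=\mathfrak C_{Alg}(A)\oplus\mathfrak C_{RBO}(A),\qquad \mathfrak C_{Alg}(A)=\bigoplus_{n\ge0}\mathrm{Hom}((sA)^{\otimes n},sA),\quad \mathfrak C_{RBO}(A)=\bigoplus_{n\ge0}\mathrm{Hom}((sA)^{\otimes n},A),$$ whose $n$-th summands have degrees $1-n$ and $-n$. For $F,G_1,\dots,G_r\in\mathfrak C_{Alg}(A)$ the brace $F\{G_1,\dots,G_r\}$ is the sum of all insertions of $G_1,\dots,G_r$, in this order, into $F$, with Koszul signs ($F\{\}=F$), and $[F,G]_G=F\{G\}-(-1)^{|F||G|}G\{F\}$. The multilinear operations $l_n$ of the $L_\infty$-algebra $\mathfrak C_{RBA}(A)$ are the following. * $l_1(sh)=h$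 for $sh\in\mathrm{Hom}(k,sA)$; $l_2(sf\otimes sh)=[sf,sh]_G$ for $sf,sh\in\mathfrak C_{Alg}(A)$. * For $sh\in\mathrm{Hom}((sA)^{\otimes n},sA)$ and homogeneous $g_1,\dots,g_m\in\mathfrak C_{RBO}(A)$ with $1\le m\le n$, $$l_{m+1}(sh\otimes g_1\otimes\cdots\otimes g_m)=\sum_{\sigma\in S_m}\chi(\sigma;g_1,\dots,g_m)\,(-1)^{m(|h|+1)+\sum_{i=1}^{m-1}\sum_{j=1}^{i}|g_{\sigma(j)}|}\,\big(P_\sigma-(-1)^{(|g_{\sigma(1)}|+1)(|h|+1)}\lambda^{n-m}\,s^{-1}(sg_{\sigma(1)})\{sh\{sg_{\sigma(2)},\dots,sg_{\sigma(m)}\}\}\big),$$ where $P_\sigma=h\circ(sg_{\sigma(1)}\otimes\cdots\otimes sg_{\sigma(m)})$ if $m=n$, $P_\sigma=0$ if $m<n$, and $\chi(\sigma;g_1,\dots,g_m)$ is the sign of $\sigma$ times its Koszul sign. * $l_{m+1}(g_1\otimes\cdots\otimes g_j\otimes sh\otimes g_{j+1}\otimes\cdots\otimes g_m)=(-1)^{(|h|+1)(|g_1|+\cdots+|g_j|)+j}\,l_{m+1}(sh\otimes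 g_1\otimes\cdots\otimes g_m)$; all other components vanish. Let $\alpha=(m,\tau)$ with $m=-s\circ\mu\circ(s^{-1}\otimes s^{-1})$ and $\tau=T\circ s^{-1}$. On the cochain side let $C^n_{Alg}(A)=C^n_{RBO}(A)=\mathrm{Hom}(A^{\otimes n},A)$. The differential $\delta$ of $C^\bullet_{Alg}(A)$ is the Hochschild differential $$\delta f(a_{1,n+1})=(-1)^{n+1}a_1f(a_{2,n+1})+\sum_{i=1}^n(-1)^{n-i+1}f(a_1,\dots,a_ia_{i+1},\dots,a_{n+1})+f(a_{1,n})a_{n+1}.$$ The differential $\partial$ of $C^\bullet_{RBO}(A)$ is given by the same formula with the product $a\star b=aT(b)+T(a)b+\lambda ab$, the left action $a\rhd x=T(a)x-T(ax)$ and the right action $x\lhd a=xT(a)-T(xa)$ on $A$. Let $$\Phi^n(f)(a_{1,n})=f(Ta_1,\dots,Ta_n)-\sum_{S\subsetneq\{1,\dots,n\}}\lambda^{n-|S|-1}\,T\big(f(a^S_1,\dots,a^S_n)\big),\qquad a^S_i=Ta_i\ (i\in S),\quad a^S_i=a_i\ (i\notin S),$$ so that $\Phi^0=\mathrm{id}$.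 Let $C^0_{RBA}(A)=C^0_{Alg}(A)$, $C^n_{RBA}(A)=C^n_{Alg}(A)\oplus C^{n-1}_{RBO}(A)$ for $n\ge1$, and $d(f,g)=(\delta f,-\partial g-\Phi f)$. Then: 1. $\alpha$ is a Maurer–Cartan element: it has degree $-1$, and $\sum_{n\ge1}\frac1{n!}(-1)^{n(n-1)/2}l_n(\alpha^{\otimes n})=0$, a finite sum. For all $n\ge1$ the sums $l_n^\alpha(x_1\otimes\cdots\otimes x_n)=\sum_{i\ge0}\frac1{i!}(-1)^{in+i(i-1)/2}l_{n+i}(\alpha^{\otimes i}\otimes x_1\otimes\cdots\otimes x_n)$ that define the twisted operations are finite. 2. $\delta^2=0$, $\partial^2=0$ and $\Phi\delta=\partial\Phi$, so $\Phi$ is a chain map; and $d^2=0$, so $C^\bullet_{RBA}(A)$, the negative shift of the mapping cone of $\Phi$, is a complex. 3. The underlying complex $(\mathfrak C_{RBA}(A),l_1^\alpha)$ of the twisted $L_\infty$-algebra is the shift $sC^\bullet_{RBA}(A)$: $(l_1^\alpha)^2=0$, and the maps $f\mapsto s^{-1}\circ f\circ s^{\otimes n}$ on $\mathrm{Hom}((sA)^{\otimes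 n},sA)$ and $g\mapsto g\circ s^{\otimes n}$ on $\mathrm{Hom}((sA)^{\otimes n},A)$ form a linear isomorphism $\Psi:\mathfrak C_{RBA}(A)\to\bigoplus_nC^n_{RBA}(A)$ that identifies the degree $1-n$ part with $C^n_{RBA}(A)$ and satisfies $\Psi\circ l_1^\alpha=-d\circ\Psi$, where $-d$ is the differential of the shift. -/

import Mathlib

open scoped DirectSum Nat

noncomputable section

namespace RotaBaxter

/-! ### Rota-Baxter algebras -/

section Classical

variable (k : Type*) [Field k] {A M : Type*} [AddCommGroup A] [Module k A]
  [AddCommGroup M] [Module k M]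

variable {k}

/-- `(A, mul, T)` is a (not necessarily unital) associative algebra with a Rota-Baxter operator `T`
of weight `lam`. -/
structure IsRotaBaxterAlgebra (lam : k) (mul : A →ₗ[k] A →ₗ[k] A) (T : A →ₗ[k] A) : Prop where
  assoc : ∀ a b c : A, mul (mul a b) c = mul a (mul b c)
  rotaBaxter : ∀ a b : A, mul (T a) (T b) = T (mul a (T b) + mul (T a) b + lam • mul a b)

variable (k A M) in
/-- Cochains `Hom(A^{⊗ n}, M)`. -/
abbrev Coch (n : ℕ) : Type _ := MultilinearMap k (fun _ : Fin n => A) M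

/-! ### The Hochschild complex -/

theorem exists_contractNth_update (mul : A →ₗ[k] A →ₗ[k] A) {n : ℕ} (j : Fin n)
    (a : Fin (n + 1) → A) (i : Fin (n + 1)) :
    ∃ (t : Fin n) (g : A →ₗ[k] A), ∀ z : A,
      Fin.contractNth j.castSucc (fun x y => mul x y) (Function.update a i z) =
        Function.update (Fin.contractNth j.castSucc (fun x y => mul x y) a) t (g z) := by
  rcases lt_trichotomy (i : ℕ) (j : ℕ) with h | h | h
  · refine ⟨⟨i, by omega⟩, LinearMap.id, fun z => ?_⟩
    funext s
    simp only [Fin.contractNth, Function.update_apply, Fin.ext_iff, Fin.val_castSucc, Fin.val_succ,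
      LinearMap.id_apply]
    grind
  · refine ⟨j, mul.flip (a j.succ), fun z => ?_⟩
    funext s
    simp only [Fin.contractNth, Function.update_apply, Fin.ext_iff, Fin.val_castSucc, Fin.val_succ,
      LinearMap.flip_apply]
    grind
  · rcases Nat.lt_or_ge ((j : ℕ) + 1) i with h' | h'
    · refine ⟨⟨i - 1, by omega⟩, LinearMap.id, fun z => ?_⟩
      funext s
      simp only [Fin.contractNth, Function.update_apply, Fin.ext_iff, Fin.val_castSucc,
        Fin.val_succ, LinearMap.id_apply]
      grind
    · refine ⟨j, mul (a j.castSucc), fun z => ?_⟩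
      funext s
      simp only [Fin.contractNth, Function.update_apply, Fin.ext_iff, Fin.val_castSucc,
        Fin.val_succ]
      grind

/-- `a ↦ f(a_1, …, a_j a_{j+1}, …, a_{n+1})`, with `j` counted from `0`. -/
def hochMid (mul : A →ₗ[k] A →ₗ[k] A) {n : ℕ} (j : Fin n) (f : Coch k A M n) :
    Coch k A M (n + 1) where
  toFun a := f (Fin.contractNth j.castSucc (fun x y => mul x y) a)
  map_update_add' {inst} a i x y := by
    rw [Subsingleton.elim inst (instDecidableEqFin _)]
    obtain ⟨t, g, h⟩ := exists_contractNth_update mul j a i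
    simp only [h, map_add, f.map_update_add]
  map_update_smul' {inst} a i c x := by
    rw [Subsingleton.elim inst (instDecidableEqFin _)]
    obtain ⟨t, g, h⟩ := exists_contractNth_update mul j a i
    simp only [h, map_smul, f.map_update_smul]

/-- `a ↦ a_1 f(a_2, …, a_{n+1})`, for a left action `l`. -/
def hochLeft (l : A →ₗ[k] M →ₗ[k] M) {n : ℕ} (f : Coch k A M n) : Coch k A M (n + 1) :=
  LinearMap.uncurryLeft (M := fun _ : Fin (n + 1) => A)
    { toFun := fun a => (l a).compMultilinearMap f
      map_add' := fun a b => by ext v; simp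
      map_smul' := fun c a => by ext v; simp }

/-- `a ↦ f(a_1, …, a_n) a_{n+1}`, for a right action `r` (`r m a` is `m a`). -/
def hochRight (r : M →ₗ[k] A →ₗ[k] M) {n : ℕ} (f : Coch k A M n) : Coch k A M (n + 1) :=
  MultilinearMap.uncurryRight (M := fun _ : Fin (n + 1) => A) (r.compMultilinearMap f)

/-- The Hochschild differential `C^n → C^{n+1}` of the algebra `(A, mul)` with coefficients in `M`
with left action `l` and right action `r`:
`(-1)^{n+1} a_1 f(a_{2,n+1}) + ∑_{i=1}^n (-1)^{n-i+1} f(…, a_i a_{i+1}, …) + f(a_{1,n}) a_{n+1}`;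
the index `j` below is `i - 1`. -/
def hochDiff (mul : A →ₗ[k] A →ₗ[k] A) (l : A →ₗ[k] M →ₗ[k] M) (r : M →ₗ[k] A →ₗ[k] M) (n : ℕ) :
    Coch k A M n →ₗ[k] Coch k A M (n + 1) where
  toFun f := (-1 : k) ^ (n + 1) • hochLeft l f + ∑ j : Fin n, (-1 : k) ^ (n - (j : ℕ)) • hochMid mul j f
    + hochRight r f
  map_add' f g := by
    ext v
    simp [hochLeft, hochMid, hochRight, Finset.sum_add_distrib, smul_add]
    abel
  map_smul' c f := by
    ext v
    simp [hochLeft, hochMid, hochRight, Finset.smul_sum, smul_add, smul_comm c]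

/-! ### The cochain complex of the Rota-Baxter operator -/

/-- `a ⋆ b = a T(b) + T(a) b + lam a b`. -/
def starMul (lam : k) (mul : A →ₗ[k] A →ₗ[k] A) (T : A →ₗ[k] A) : A →ₗ[k] A →ₗ[k] A :=
  mul.compl₂ T + mul ∘ₗ T + lam • mul

/-- `a ▷ m = T(a) m - T_M(a m)`. -/
def leftAct (T : A →ₗ[k] A) (TM : M →ₗ[k] M) (l : A →ₗ[k] M →ₗ[k] M) : A →ₗ[k] M →ₗ[k] M :=
  l ∘ₗ T - l.compr₂ TM

/-- `m ◁ a = m T(a) - T_M(m a)`. -/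
def rightAct (T : A →ₗ[k] A) (TM : M →ₗ[k] M) (r : M →ₗ[k] A →ₗ[k] M) : M →ₗ[k] A →ₗ[k] M :=
  r.compl₂ T - r.compr₂ TM

/-- The differential `∂` of `C_RBO(A, M)`: the Hochschild differential of `A_⋆` with coefficients in
`M` with the actions `▷`, `◁`. -/
def rboDiff (lam : k) (mul : A →ₗ[k] A →ₗ[k] A) (T : A →ₗ[k] A) (TM : M →ₗ[k] M)
    (l : A →ₗ[k] M →ₗ[k] M) (r : M →ₗ[k] A →ₗ[k] M) (n : ℕ) :
    Coch k A M n →ₗ[k] Coch k A M (n + 1) :=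
  hochDiff (starMul lam mul T) (leftAct T TM l) (rightAct T TM r) n

/-- `Φ^n(f) = f ∘ T^{⊗ n} - ∑_{k=0}^{n-1} lam^{n-k-1} ∑_{i_1 < ⋯ < i_k} T_M ∘ f(… T(a_{i_1}) …)`,
where exactly the arguments with index in `S = {i_1, …, i_k}` are hit by `T`.  For `n = 0` this is
the identity. -/
def Phi (lam : k) (T : A →ₗ[k] A) (TM : M →ₗ[k] M) (n : ℕ) : Coch k A M n →ₗ[k] Coch k A M n :=
  MultilinearMap.compLinearMapₗ (fun _ : Fin n => T) -
    ∑ j ∈ Finset.range n, lam ^ (n - j - 1) •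
      ∑ S ∈ Finset.powersetCard j (Finset.univ : Finset (Fin n)),
        TM.compMultilinearMapₗ k ∘ₗ
          MultilinearMap.compLinearMapₗ (fun i : Fin n => if i ∈ S then T else LinearMap.id)

/-! ### The cochain complex of the Rota-Baxter algebra -/

variable (k A M) in
/-- `C^0_RBA = C^0_Alg` and `C^{n+1}_RBA = C^{n+1}_Alg ⊕ C^n_RBO`. -/
def CochRBA : ℕ → Type _
  | 0 => Coch k A M 0
  | n + 1 => Coch k A M (n + 1) × Coch k A M n

instance : ∀ n, AddCommGroup (CochRBA k A M n)
  | 0 => inferInstanceAs (AddCommGroup (Coch k A M 0))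
  | n + 1 => inferInstanceAs (AddCommGroup (Coch k A M (n + 1) × Coch k A M n))

instance : ∀ n, Module k (CochRBA k A M n)
  | 0 => inferInstanceAs (Module k (Coch k A M 0))
  | n + 1 => inferInstanceAs (Module k (Coch k A M (n + 1) × Coch k A M n))

variable (k A M) in
/-- The inclusion `C^n_Alg → C^n_RBA`. -/
def inclAlg : ∀ n, Coch k A M n →ₗ[k] CochRBA k A M n
  | 0 => (LinearMap.id : Coch k A M 0 →ₗ[k] Coch k A M 0)
  | n + 1 => LinearMap.inl k (Coch k A M (n + 1)) (Coch k A M n)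

variable (k A M) in
/-- The inclusion `C^n_RBO → C^{n+1}_RBA`. -/
def inclRBO (n : ℕ) : Coch k A M n →ₗ[k] CochRBA k A M (n + 1) :=
  LinearMap.inr k (Coch k A M (n + 1)) (Coch k A M n)

/-- The differential of the negative shift of the mapping cone of `Φ`:
`d(f, g) = (δ f, - ∂ g - Φ f)`. -/
def rbaDiff (lam : k) (mul : A →ₗ[k] A →ₗ[k] A) (T : A →ₗ[k] A) (TM : M →ₗ[k] M)
    (l : A →ₗ[k] M →ₗ[k] M) (r : M →ₗ[k] A →ₗ[k] M) :
    ∀ n, CochRBA k A M n →ₗ[k] CochRBA k A M (n + 1)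
  | 0 =>
    ((hochDiff mul l r 0).prod (-(Phi lam T TM 0)) :
      Coch k A M 0 →ₗ[k] Coch k A M 1 × Coch k A M 0)
  | n + 1 =>
    ((hochDiff mul l r (n + 1) ∘ₗ LinearMap.fst k _ _).prod
      (-(rboDiff lam mul T TM l r n ∘ₗ LinearMap.snd k _ _) -
        Phi lam T TM (n + 1) ∘ₗ LinearMap.fst k _ _) :
      Coch k A M (n + 1) × Coch k A M n →ₗ[k] Coch k A M (n + 2) × Coch k A M (n + 1))

/-- The differential of `C_RBA = ⨁ n, C^n_RBA`. -/
def rbaTotalDiff (lam : k) (mul : A →ₗ[k] A →ₗ[k] A) (T : A →ₗ[k] A) (TM : M →ₗ[k] M)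
    (l : A →ₗ[k] M →ₗ[k] M) (r : M →ₗ[k] A →ₗ[k] M) :
    (⨁ n, CochRBA k A M n) →ₗ[k] (⨁ n, CochRBA k A M n) :=
  DirectSum.toModule k ℕ _ fun n =>
    DirectSum.lof k ℕ (CochRBA k A M) (n + 1) ∘ₗ rbaDiff lam mul T TM l r n

end Classical

/-! ### The graded space `𝔠_RBA(A)` for `A` concentrated in degree `0` -/

/-- The suspension `sA`, concentrated in degree `1`. -/
def Susp (A : Type*) : Type _ := A

section Graded

variable {k : Type*} [Field k] {A : Type*} [AddCommGroup A] [Module k A]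

instance : AddCommGroup (Susp A) := inferInstanceAs (AddCommGroup A)

instance : Module k (Susp A) := inferInstanceAs (Module k A)

variable (k A) in
/-- The suspension map `s : A → sA`. -/
def susp : A ≃ₗ[k] Susp A := LinearEquiv.refl k A

variable (k A) in
/-- `Hom((sA)^{⊗ n}, sA)`, the component of `𝔠_Alg(A) = Hom(T^c(sA), sA)` of degree `1 - n`. -/
abbrev CAlg (n : ℕ) : Type _ := MultilinearMap k (fun _ : Fin n => Susp A) (Susp A)

variable (k A) in
/-- `Hom((sA)^{⊗ n}, A)`, the component of `𝔠_RBO(A) = Hom(T^c(sA), A)` of degree `-n`. -/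
abbrev CRBO (n : ℕ) : Type _ := MultilinearMap k (fun _ : Fin n => Susp A) A

variable (k A) in
/-- `𝔠_RBA(A) = 𝔠_Alg(A) ⊕ 𝔠_RBO(A)`. -/
abbrev CRBA : Type _ := (⨁ n, CAlg k A n) × (⨁ n, CRBO k A n)

/-- Elements of `𝔠_Alg(A)` that are homogeneous for the number of arguments. -/
abbrev AlgElt (k A : Type*) [Field k] [AddCommGroup A] [Module k A] : Type _ := Σ n, CAlg k A n

variable (k A) in
/-- The subspace of `𝔠_RBA(A)` of (homological) degree `d`. -/
def homogeneous (d : ℤ) : Submodule k (CRBA k A) where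
  carrier := {x | (∀ n : ℕ, 1 - (n : ℤ) ≠ d → x.1 n = 0) ∧ (∀ n : ℕ, -(n : ℤ) ≠ d → x.2 n = 0)}
  add_mem' hx hy := ⟨fun n hn => by simp [hx.1 n hn, hy.1 n hn],
    fun n hn => by simp [hx.2 n hn, hy.2 n hn]⟩
  zero_mem' := ⟨fun _ _ => rfl, fun _ _ => rfl⟩
  smul_mem' c x hx := ⟨fun n hn => by simp [DirectSum.smul_apply, hx.1 n hn],
    fun n hn => by simp [DirectSum.smul_apply, hx.2 n hn]⟩

/-- `g ↦ s g = s ∘ g`. -/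
def suspOut (n : ℕ) : CRBO k A n →ₗ[k] CAlg k A n := (susp k A).toLinearMap.compMultilinearMapₗ k

/-- `f ↦ s⁻¹ f = s⁻¹ ∘ f`. -/
def desuspOut (n : ℕ) : CAlg k A n →ₗ[k] CRBO k A n :=
  (susp k A).symm.toLinearMap.compMultilinearMapₗ k

variable (k A) in
/-- `f ↦ s⁻¹ f` on `𝔠_Alg(A)`. -/
def desuspTotal : (⨁ n, CAlg k A n) →ₗ[k] (⨁ n, CRBO k A n) :=
  DirectSum.toModule k ℕ _ fun n => DirectSum.lof k ℕ (CRBO k A) n ∘ₗ desuspOut n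

/-! ### Braces and the Gerstenhaber bracket -/

/-- `F ∘ (w_1 ⊗ ⋯ ⊗ w_n)` for `w_t ∈ Hom((sA)^{⊗ q_t}, sA)`.  As `|w_t| = 1 - q_t` and the elements
of `sA` have degree `1`, the Koszul rule gives the sign
`∏_t (-1)^{(1 - q_t) (q_1 + ⋯ + q_{t-1})}`. -/
def tensComp {n : ℕ} (F : CAlg k A n) (w : Fin n → AlgElt k A) : CAlg k A (∑ t, (w t).1) :=
  (∑ t, (1 - ((w t).1 : ℤ)) * ∑ t' ∈ Finset.univ.filter (· < t), ((w t').1 : ℤ)).negOnePow •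
    (F.compMultilinearMap fun t => (w t).2).domDomCongr finSigmaFinEquiv

/-- The identity of `sA`. -/
def idElt : AlgElt k A := ⟨1, MultilinearMap.ofSubsingleton k (Susp A) (Susp A) 0 LinearMap.id⟩

open Classical in
/-- The slots `1, …, m` filled in with `G_1, …, G_r` in the places `e 1 < ⋯ < e r` and with
identities in the other places. -/
def slots {m r : ℕ} (e : Fin r ↪o Fin m) (G : Fin r → AlgElt k A) (t : Fin m) : AlgElt k A :=
  if h : ∃ i, e i = t then G h.choose else idElt

/-- The brace `F{G_1, …, G_r}`, for `F` with `m` arguments, is the signed sum of all insertions of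
`G_1, …, G_r`, in this order, into `F`. -/
def brace {m r : ℕ} (F : CAlg k A m) (G : Fin r → AlgElt k A) : ⨁ n, CAlg k A n :=
  ∑ e : Fin r ↪o Fin m, DirectSum.lof k ℕ (CAlg k A) _ (tensComp F (slots e G))

open Classical in
/-- The brace `F{X}` for an arbitrary `X ∈ 𝔠_Alg(A)`, extended linearly in `X`. -/
def braceOne {m : ℕ} (F : CAlg k A m) (X : ⨁ n, CAlg k A n) : ⨁ n, CAlg k A n :=
  ∑ n ∈ DFinsupp.support X, brace F (fun _ : Fin 1 => (⟨n, X n⟩ : AlgElt k A))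

open Classical in
/-- The Gerstenhaber bracket `[F, G] = F{G} - (-1)^{|F| |G|} G{F}`, extended bilinearly. -/
def gerst (X Y : ⨁ n, CAlg k A n) : ⨁ n, CAlg k A n :=
  ∑ m ∈ DFinsupp.support X, ∑ n ∈ DFinsupp.support Y,
    (brace (X m) (fun _ : Fin 1 => (⟨n, Y n⟩ : AlgElt k A)) -
      ((1 - (m : ℤ)) * (1 - (n : ℤ))).negOnePow •
        brace (Y n) (fun _ : Fin 1 => (⟨m, X m⟩ : AlgElt k A)))

/-! ### The operations `l_n` -/

/-- The Koszul sign `χ(σ; x_1, …, x_r) = sgn(σ) ε(σ; x_1, …, x_r)` for `|x_i| = d i`, with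
`ε = ∏ (-1)^{|x_{σ(i)}| |x_{σ(j)}|}` over the pairs `i < j` with `σ(i) > σ(j)`. -/
def chi {r : ℕ} (σ : Equiv.Perm (Fin r)) (d : Fin r → ℤ) : ℤˣ :=
  Equiv.Perm.sign σ *
    (∑ i : Fin r, ∑ j : Fin r, if i < j ∧ σ j < σ i then d (σ i) * d (σ j) else 0).negOnePow

/-- `l_{m+2}(sh ⊗ g_1 ⊗ ⋯ ⊗ g_{m+1})` for `sh ∈ Hom((sA)^{⊗ n}, sA)` and
`g_i ∈ Hom((sA)^{⊗ p_i}, A)`.  Here `|h| = -n` and `|g_i| = -p_i`.  With `r = m + 1`, the sign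
outside the bracket is
`χ(σ; g_1, …, g_r) (-1)^{r (|h| + 1) + ∑_{i=1}^{r-1} ∑_{j=1}^i |g_{σ(j)}|}`; the bracket is
`h ∘ (sg_{σ(1)} ⊗ ⋯ ⊗ sg_{σ(r)}) - (-1)^{(|g_{σ(1)}|+1)(|h|+1)} s⁻¹(sg_{σ(1)}){sh{sg_{σ(2)}, …}}` if
`n = r`, and `-(-1)^{(|g_{σ(1)}|+1)(|h|+1)} lam^{n-r} s⁻¹(sg_{σ(1)}){sh{sg_{σ(2)}, …}}` if `r < n`.
The operation is zero if `n < r`. -/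
def opMixed (lam : k) {n m : ℕ} (sh : CAlg k A n) (p : Fin (m + 1) → ℕ)
    (g : ∀ i, CRBO k A (p i)) : ⨁ u, CRBO k A u :=
  ∑ σ : Equiv.Perm (Fin (m + 1)),
    (chi σ (fun i => -(p i : ℤ)) *
      (((m : ℤ) + 1) * (1 - (n : ℤ)) +
        ∑ i : Fin m, ∑ j ∈ Finset.univ.filter (· ≤ i), -(p (σ j.castSucc) : ℤ)).negOnePow) •
    ((if h : m + 1 = n then
        desuspTotal k A (DirectSum.lof k ℕ (CAlg k A) _
          (tensComp (sh.domDomCongr (finCongr h.symm))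
            (fun i => (⟨p (σ i), suspOut _ (g (σ i))⟩ : AlgElt k A))))
      else 0) -
      (if m + 1 ≤ n then
        ((1 - (p (σ 0) : ℤ)) * (1 - (n : ℤ))).negOnePow • lam ^ (n - (m + 1)) •
          desuspTotal k A (braceOne (suspOut _ (g (σ 0)))
            (brace sh (fun i : Fin m =>
              (⟨p (σ i.succ), suspOut _ (g (σ i.succ))⟩ : AlgElt k A))))
      else 0))

open Classical in
/-- The operations `l_n` of `𝔠_RBA(A)`, as the multilinear extensions of their values on homogeneous
elements; the sums run over the (finitely many) homogeneous components of the arguments.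
* `l_1(sh) = h` for `sh ∈ Hom(k, sA)`, and `l_1` is zero on all other components.
* On `𝔠_Alg(A)`, `l_2` is the Gerstenhaber bracket.
* For `sh ∈ 𝔠_Alg(A)` in the argument number `j + 1` and `g_i ∈ 𝔠_RBO(A)` in the other ones,
  `l_{r+1}(g_1 ⊗ ⋯ ⊗ g_j ⊗ sh ⊗ g_{j+1} ⊗ ⋯ ⊗ g_r)` is
  `(-1)^{(|h|+1)(|g_1| + ⋯ + |g_j|) + j} l_{r+1}(sh ⊗ g_1 ⊗ ⋯ ⊗ g_r)`, for `r ≥ 1`.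
* All other components are zero. -/
def op (lam : k) : ∀ N : ℕ, (Fin N → CRBA k A) → CRBA k A
  | 0, _ => 0
  | 1, x => (0, DirectSum.lof k ℕ (CRBO k A) 0 (desuspOut 0 ((x 0).1 0)))
  | m + 2, x =>
    (if m = 0 then gerst (x 0).1 (x 1).1 else 0,
      ∑ j : Fin (m + 2), ∑ n ∈ DFinsupp.support (x j).1,
        ∑ p ∈ Fintype.piFinset (fun i : Fin (m + 1) => DFinsupp.support (x (j.succAbove i)).2),
          ((1 - (n : ℤ)) *
              (∑ i ∈ Finset.univ.filter (fun i : Fin (m + 1) => (i : ℕ) < j), -(p i : ℤ)) +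
            (j : ℤ)).negOnePow •
            opMixed lam ((x j).1 n) p (fun i => (x (j.succAbove i)).2 (p i)))

/-! ### Maurer-Cartan elements and twisting -/

section Twisting

variable {L : Type*} [AddCommGroup L] [Module k L]

/-- The term `(1 / (n+1)!) (-1)^{(n+1) n / 2} l_{n+1}(α^{⊗ (n+1)})` of the Maurer-Cartan
equation. -/
def mcTerm (l : ∀ N : ℕ, (Fin N → L) → L) (α : L) (n : ℕ) : L :=
  (((n + 1)! : k)⁻¹ * (-1) ^ ((n + 1) * n / 2)) • l (n + 1) (fun _ => α)

/-- The term `(1 / i!) (-1)^{i n + i (i-1) / 2} l_{n+i}(α^{⊗ i} ⊗ x_1 ⊗ ⋯ ⊗ x_n)` of the twisted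
operation. -/
def twistTerm (l : ∀ N : ℕ, (Fin N → L) → L) (α : L) (n : ℕ) (x : Fin n → L) (i : ℕ) : L :=
  ((i ! : k)⁻¹ * (-1) ^ (i * n + i * (i - 1) / 2)) • l (i + n) (Fin.append (fun _ => α) x)

variable (k) in
/-- The twisted operation `l_n^α` (to be used when only finitely many terms are nonzero). -/
def twist (l : ∀ N : ℕ, (Fin N → L) → L) (α : L) (n : ℕ) (x : Fin n → L) : L :=
  ∑ᶠ i, twistTerm (k := k) l α n x i

end Twisting

/-- `α` is a Maurer-Cartan element of `𝔠_RBA(A)`: it has degree `-1`, the sum in the Maurer-Cartan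
equation exists (is finite), and it is zero. -/
structure IsMaurerCartan (lam : k) (α : CRBA k A) : Prop where
  degree : α ∈ homogeneous k A (-1)
  finite : (Function.support (mcTerm (k := k) (op lam) α)).Finite
  equation : ∑ᶠ n, mcTerm (k := k) (op lam) α n = 0

/-! ### The Maurer-Cartan element of a Rota-Baxter algebra and the comparison map -/

/-- `m = -s ∘ μ ∘ (s⁻¹ ⊗ s⁻¹)`, i.e. `m(sa ⊗ sb) = s(a b)`: the Koszul rule gives
`(s⁻¹ ⊗ s⁻¹)(sa ⊗ sb) = -(a ⊗ b)`. -/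
def mcAlg (mul : A →ₗ[k] A →ₗ[k] A) : CAlg k A 2 :=
  MultilinearMap.mk' (fun x => susp k A (mul ((susp k A).symm (x 0)) ((susp k A).symm (x 1))))
    (fun x i a b => by fin_cases i <;> simp)
    (fun x i c a => by fin_cases i <;> simp)

/-- The element `α = (m, τ)` with `τ = T ∘ s⁻¹`. -/
def mcElement (mul : A →ₗ[k] A →ₗ[k] A) (T : A →ₗ[k] A) : CRBA k A :=
  (DirectSum.lof k ℕ (CAlg k A) 2 (mcAlg mul),
    DirectSum.lof k ℕ (CRBO k A) 1
      (MultilinearMap.ofSubsingleton k (Susp A) A 0 (T ∘ₗ (susp k A).symm.toLinearMap)))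

/-- `f ↦ s⁻¹ ∘ f ∘ s^{⊗ n}`; there are no Koszul signs in `s^{⊗ n}` as `A` has degree `0`. -/
def tilde (n : ℕ) : CAlg k A n →ₗ[k] Coch k A A n :=
  MultilinearMap.compLinearMapₗ (fun _ : Fin n => (susp k A).toLinearMap) ∘ₗ desuspOut n

/-- `g ↦ g ∘ s^{⊗ n}`. -/
def hat (n : ℕ) : CRBO k A n →ₗ[k] Coch k A A n :=
  MultilinearMap.compLinearMapₗ (fun _ : Fin n => (susp k A).toLinearMap)

variable (k A) in
/-- The identification of the graded space `𝔠_RBA(A)` with (the shift of) `C_RBA(A)` through the two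
fixed isomorphisms `f ↦ tilde f`, `g ↦ hat g`. -/
def comparison : CRBA k A →ₗ[k] (⨁ n, CochRBA k A A n) :=
  LinearMap.coprod
    (DirectSum.toModule k ℕ _ fun n =>
      DirectSum.lof k ℕ (CochRBA k A A) n ∘ₗ inclAlg k A A n ∘ₗ tilde n)
    (DirectSum.toModule k ℕ _ fun n =>
      DirectSum.lof k ℕ (CochRBA k A A) (n + 1) ∘ₗ inclRBO k A A n ∘ₗ hat n)

end Graded

end RotaBaxter

end

noncomputable section

namespace RotaBaxter

/-! ### Evaluation of multilinear maps on sequences -/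

/-! Everything reduces to three computations.

On the cochain side, `Φ` becomes tractable once the sum over proper subsets, weighted by powers of
`lam`, is replaced by the sum of the `n` "stairs" `f(T v_0, …, T v_{j-1}, v_j, (T + lam) v_{j+1},
…)` (`sum_proper_subsets`). Both `T` and `T + lam` are multiplicative from `⋆` to the original
product, and `a (T + lam) b + T(a) b = a ⋆ b`; so contracting neighbours in `n + 1` stairs gives `n`
stairs of a `⋆`-contraction (`sum_stair_seqContract`), and `Φ δ = ∂ Φ` follows. `⋆` is associative
and `▷`, `◁` are bimodule actions by the Rota-Baxter identity, so one general proof of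
`hochDiff_comp_hochDiff` gives both `δ² = 0` and `∂² = 0`.

On the operadic side, the bracket with `m` is `δ` (`gerst_mcAlg`). The operation with `f` and `r`
copies of `τ` is, up to `r!` and a sign, the part of `Φ f` with subsets of size `r - 1` together
with `f ∘ T^{⊗ n}` when `r = n` (`opFam_tau`). The operations on `m`, `g` and on `m`, `τ`, `g` add
up to `-∂ g` (`opFam_mcAlg`).

The factorials and signs of the twisting formula cancel exactly, so `l_1^α(f, g) = (-δ f, Φ f + ∂
g)` for any product and any `T` (`twist_one`); this is `-d` under the comparison map, and `(l_1^α)²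
= 0` is then read off from `d² = 0`. The same count turns the Maurer-Cartan equation into `δ μ = 0`
and `Φ μ = 0`, that is, associativity and the Rota-Baxter identity. Only finitely many terms occur,
because an element with `n` arguments accepts at most `n` insertions. -/

/-- The first `n` terms of a sequence. -/
def trunc {B : Type*} (n : ℕ) (v : ℕ → B) : Fin n → B := fun i => v i

@[simp]
theorem trunc_apply {B : Type*} (n : ℕ) (v : ℕ → B) (i : Fin n) : trunc n v i = v i := rfl

/-- The sequence `v_0, …, v_j v_{j+1}, …`. -/
def seqContract {B : Type*} (op : B → B → B) (j : ℕ) (v : ℕ → B) : ℕ → B := fun i =>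
  if i < j then v i else if i = j then op (v j) (v (j + 1)) else v (i + 1)

theorem contractNth_trunc {B : Type*} (op : B → B → B) {n : ℕ} (j : Fin n) (v : ℕ → B) :
    Fin.contractNth j.castSucc op (trunc (n + 1) v) = trunc n (seqContract op j v) := by
  funext i
  simp only [Fin.contractNth, trunc, seqContract, Fin.val_castSucc, Fin.val_succ]
  grind

theorem seqContract_seqContract {B : Type*} {op : B → B → B}
    (h : ∀ a b c, op (op a b) c = op a (op b c)) {i j : ℕ} (hij : j ≤ i) (v : ℕ → B) :
    seqContract op i (seqContract op j v) = seqContract op j (seqContract op (i + 1) v) := by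
  funext t
  simp only [seqContract]
  grind

section Classical

variable {k : Type*} [Field k] {A M : Type*} [AddCommGroup A] [Module k A]
  [AddCommGroup M] [Module k M]

/-- Any tuple is the truncation of its extension by zero. Working with infinite sequences keeps
arities out of the types, so that contractions and shifts can be composed without casts. -/
theorem ext_trunc {n : ℕ} {f g : Coch k A M n}
    (h : ∀ v : ℕ → A, f (trunc n v) = g (trunc n v)) : f = g := by
  ext a
  have : a = trunc n (fun i => if h : i < n then a ⟨i, h⟩ else 0) := by
    funext i
    simp
  rw [this]
  exact h _

/-! ### The Hochschild differential on sequences, and its square -/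

theorem hochDiff_trunc (mul : A →ₗ[k] A →ₗ[k] A) (l : A →ₗ[k] M →ₗ[k] M)
    (r : M →ₗ[k] A →ₗ[k] M) (n : ℕ) (f : Coch k A M n) (v : ℕ → A) :
    hochDiff mul l r n f (trunc (n + 1) v) =
      (-1 : k) ^ (n + 1) • l (v 0) (f (trunc n fun i => v (i + 1))) +
      ∑ j ∈ Finset.range n,
        (-1 : k) ^ (n - j) • f (trunc n (seqContract (fun x y => mul x y) j v)) +
      r (f (trunc n v)) (v n) := by
  have h1 : hochLeft l f (trunc (n + 1) v) = l (v 0) (f (trunc n fun i => v (i + 1))) := rfl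
  have h2 : hochRight r f (trunc (n + 1) v) = r (f (trunc n v)) (v n) := rfl
  have h3 : ∀ j : Fin n, hochMid mul j f (trunc (n + 1) v) =
      f (trunc n (seqContract (fun x y => mul x y) j v)) := fun j => by
    rw [← contractNth_trunc]
    rfl
  simp only [hochDiff, LinearMap.coe_mk, AddHom.coe_mk, add_apply,
    smul_apply, sum_apply, h1, h2, h3]
  rw [Finset.sum_range]

/-- The usual simplicial cancellation: the pair `(j, i)` with `j ≤ i` is matched with `(i + 1, j)`,
which has the same value and the opposite sign. -/
theorem sum_sum_neg_one_pow_eq_zero {n : ℕ} (X : ℕ → ℕ → M)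
    (h : ∀ i j, j ≤ i → X i j = X j (i + 1)) :
    ∑ j ∈ Finset.range (n + 1), ∑ i ∈ Finset.range n, (-1 : k) ^ (i + j) • X i j = 0 := by
  rw [Finset.sum_sigma']
  refine Finset.sum_involution
    (fun p _ => if p.1 ≤ p.2 then ⟨p.2 + 1, p.1⟩ else ⟨p.2, p.1 - 1⟩) ?_ ?_ ?_ ?_
  · rintro ⟨j, i⟩ hp
    by_cases hji : j ≤ i
    · simp only [hji, if_true, h i j hji]
      rw [← add_smul]
      convert zero_smul k _
      ring
    · obtain ⟨j, rfl⟩ : ∃ j', j = j' + 1 := ⟨j - 1, by omega⟩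
      simp only [hji, if_false, Nat.add_sub_cancel, h j i (by omega)]
      rw [← add_smul]
      convert zero_smul k _
      ring
  · rintro ⟨j, i⟩ hp _ hne
    dsimp only at hne
    split_ifs at hne with hji
    · simp only [Sigma.mk.injEq, heq_eq_eq] at hne
      omega
    · simp only [Sigma.mk.injEq, heq_eq_eq] at hne
      omega
  · rintro ⟨j, i⟩ hp
    simp only [Finset.mem_sigma, Finset.mem_range] at hp
    dsimp only
    split_ifs with hji <;> simp only [Finset.mem_sigma, Finset.mem_range] <;> omega
  · rintro ⟨j, i⟩ hp
    by_cases hji : j ≤ i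
    · simp [hji]
    · obtain ⟨j, rfl⟩ : ∃ j', j = j' + 1 := ⟨j - 1, by omega⟩
      have hij : i ≤ j := by omega
      simp [hji, hij]

/-- The Hochschild differential squares to zero. -/
theorem hochDiff_comp_hochDiff (mul : A →ₗ[k] A →ₗ[k] A) (l : A →ₗ[k] M →ₗ[k] M)
    (r : M →ₗ[k] A →ₗ[k] M) (assoc : ∀ a b c, mul (mul a b) c = mul a (mul b c))
    (hl : ∀ a b x, l (mul a b) x = l a (l b x)) (hr : ∀ x a b, r (r x a) b = r x (mul a b))
    (hlr : ∀ a x b, r (l a x) b = l a (r x b)) (n : ℕ) :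
    hochDiff mul l r (n + 1) ∘ₗ hochDiff mul l r n = 0 := by
  refine LinearMap.ext fun f => ext_trunc fun v => ?_
  set op : A → A → A := fun x y => mul x y with hop
  have hshift : ∀ j, (fun i => seqContract op (j + 1) v (i + 1)) =
      seqContract op j (fun i => v (i + 1)) := fun j => by
    funext i
    simp only [seqContract]
    grind
  have hc0 : (fun i => seqContract op 0 v (i + 1)) = fun i => v (i + 1 + 1) := by
    funext i
    simp [seqContract]
  have hlast : trunc n (seqContract op n v) = trunc n v := by
    funext i
    simp [seqContract]
  have hlast' : ∀ j ∈ Finset.range n, seqContract op j v n = v (n + 1) := fun j hj => by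
    simp only [Finset.mem_range] at hj
    simp only [seqContract]
    grind
  have hmid := sum_sum_neg_one_pow_eq_zero (k := k) (n := n)
    (fun i j => f (trunc n (seqContract op i (seqContract op j v))))
    (fun i j hij => by rw [seqContract_seqContract assoc hij])
  have hmid' : ∑ j ∈ Finset.range (n + 1), (-1 : k) ^ (n + 1 - j) •
      ∑ i ∈ Finset.range n, (-1 : k) ^ (n - i) •
        f (trunc n (seqContract op i (seqContract op j v))) = 0 := by
    -- The exponents `(n + 1 - j) + (n - i)` and `i + j` have opposite parities, so this is the
    -- negative of `hmid`.
    rw [← neg_eq_zero, ← hmid, ← Finset.sum_neg_distrib]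
    refine Finset.sum_congr rfl fun j hj => ?_
    rw [Finset.smul_sum, ← Finset.sum_neg_distrib]
    refine Finset.sum_congr rfl fun i hi => ?_
    rw [smul_smul, ← neg_smul]
    congr 1
    simp only [Finset.mem_range] at hi hj
    obtain ⟨a, rfl⟩ : ∃ a, n = i + a := ⟨n - i, by omega⟩
    obtain ⟨b, hb⟩ : ∃ b, i + a + 1 = j + b := ⟨i + a + 1 - j, by omega⟩
    rw [hb, Nat.add_sub_cancel_left, Nat.add_sub_cancel_left, ← pow_add]
    have e : (-1 : k) ^ (b + a) * (-1) ^ (i + j) = -1 := by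
      rw [← pow_add, show b + a + (i + j) = 2 * (i + a) + 1 by omega]
      simp [pow_add, pow_mul]
    have e2 : (-1 : k) ^ (i + j) * (-1) ^ (i + j) = 1 := by
      rw [← mul_pow]; simp
    linear_combination (-1 : k) ^ (b + a) * e2 - (-1 : k) ^ (i + j) * e
  simp only [LinearMap.comp_apply, LinearMap.zero_apply, zero_apply,
    hochDiff_trunc, ← hop, smul_add, Finset.sum_add_distrib, map_add, map_sum, map_smul,
    LinearMap.add_apply, LinearMap.sum_apply, LinearMap.smul_apply]
  have e1 : seqContract op 0 v 0 = mul (v 0) (v 1) := by simp [seqContract, hop]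
  have e2 : seqContract op n v n = mul (v n) (v (n + 1)) := by simp [seqContract, hop]
  have e3 : ∀ j, seqContract op (j + 1) v 0 = v 0 := fun j => by simp [seqContract]
  -- Contracting the first two arguments makes `v_0 v_1` act, which splits by the action law; the
  -- other contractions leave the left action of `v_0` alone.
  have hL : ∑ j ∈ Finset.range (n + 1), (-1 : k) ^ (n + 1 - j) • (-1 : k) ^ (n + 1) •
      l (seqContract op j v 0) (f (trunc n fun i => seqContract op j v (i + 1))) =
      (-1 : k) ^ (n + 1) • ∑ j ∈ Finset.range n, (-1 : k) ^ (n - j) •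
        l (v 0) (f (trunc n (seqContract op j fun i => v (i + 1)))) +
      l (v 0) (l (v 1) (f (trunc n fun i => v (i + 1 + 1)))) := by
    rw [Finset.sum_range_succ']
    simp only [hshift, hc0, e1, e3, hl, Finset.smul_sum, Nat.add_sub_add_right, Nat.sub_zero,
      smul_smul, ← mul_pow]
    congr 1
    · exact Finset.sum_congr rfl fun j _ => by rw [mul_comm]
    · simp
  have hR : ∑ j ∈ Finset.range (n + 1), (-1 : k) ^ (n + 1 - j) •
      r (f (trunc n (seqContract op j v))) (seqContract op j v n) =
      -(∑ j ∈ Finset.range n, (-1 : k) ^ (n - j) •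
        r (f (trunc n (seqContract op j v))) (v (n + 1))) -
      r (f (trunc n v)) (mul (v n) (v (n + 1))) := by
    rw [Finset.sum_range_succ, hlast, e2, ← Finset.sum_neg_distrib, sub_eq_add_neg]
    congr 1
    · refine Finset.sum_congr rfl fun j hj => ?_
      rw [hlast' j hj]
      simp only [Finset.mem_range] at hj
      rw [show n + 1 - j = n - j + 1 by omega, pow_succ]
      simp
    · simp
  rw [hmid', hL, hR]
  simp only [hlr, hr, pow_succ, mul_neg, mul_one, neg_smul, neg_neg, smul_neg, smul_smul,
    ← mul_pow, one_pow, one_smul]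
  abel
/-! ### The algebra `A_⋆` -/

@[simp]
theorem starMul_apply (lam : k) (mul : A →ₗ[k] A →ₗ[k] A) (T : A →ₗ[k] A) (a b : A) :
    starMul lam mul T a b = mul a (T b) + mul (T a) b + lam • mul a b := rfl

@[simp]
theorem leftAct_apply (T : A →ₗ[k] A) (TM : M →ₗ[k] M) (l : A →ₗ[k] M →ₗ[k] M) (a : A) (x : M) :
    leftAct T TM l a x = l (T a) x - TM (l a x) := rfl

@[simp]
theorem rightAct_apply (T : A →ₗ[k] A) (TM : M →ₗ[k] M) (r : M →ₗ[k] A →ₗ[k] M) (a : A) (x : M) :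
    rightAct T TM r x a = r x (T a) - TM (r x a) := rfl

namespace IsRotaBaxterAlgebra

variable {lam : k} {mul : A →ₗ[k] A →ₗ[k] A} {T : A →ₗ[k] A}

theorem map_starMul (hA : IsRotaBaxterAlgebra lam mul T) (a b : A) :
    T (starMul lam mul T a b) = mul (T a) (T b) := (hA.rotaBaxter a b).symm

theorem rboDiff_comp_rboDiff (hA : IsRotaBaxterAlgebra lam mul T) (n : ℕ) :
    rboDiff lam mul T T mul mul (n + 1) ∘ₗ rboDiff lam mul T T mul mul n = 0 := by
  refine hochDiff_comp_hochDiff _ _ _ ?_ ?_ ?_ ?_ n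
  · intro a b c
    rw [starMul_apply, hA.map_starMul, starMul_apply lam mul T a (starMul lam mul T b c),
      hA.map_starMul]
    simp only [starMul_apply, map_add, map_smul, LinearMap.add_apply, LinearMap.smul_apply,
      hA.assoc, smul_add]
    abel
  · intro a b x
    rw [leftAct_apply, hA.map_starMul]
    simp only [leftAct_apply, starMul_apply, map_add, map_smul, LinearMap.add_apply,
      LinearMap.smul_apply, map_sub, hA.assoc, hA.rotaBaxter a (mul b x)]
    abel
  · intro x a b
    rw [rightAct_apply _ _ _ (starMul lam mul T a b), hA.map_starMul]
    simp only [rightAct_apply, starMul_apply, map_add, map_smul, LinearMap.sub_apply,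
      map_sub, hA.assoc, hA.rotaBaxter (mul x a) b]
    abel
  · intro a x b
    simp only [leftAct_apply, rightAct_apply, map_sub, LinearMap.sub_apply, hA.assoc,
      hA.rotaBaxter (mul a x) b, hA.rotaBaxter a (mul x b), map_add, map_smul]
    abel

end IsRotaBaxterAlgebra

/-! ### The chain map `Φ` -/

/-- `T v_0, …, T v_{j-1}, v_j, (T + lam) v_{j+1}, (T + lam) v_{j+2}, …`. -/
def stair (lam : k) (T : A →ₗ[k] A) (j : ℕ) (v : ℕ → A) : ℕ → A := fun i =>
  if i < j then T (v i) else if i = j then v i else T (v i) + lam • v i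

/-- A telescoping sum: between `T + lam` everywhere and `T` everywhere, the places are changed one
at a time, and the change in place `j` costs `lam` times the stair at `j`. -/
theorem apply_trunc_add_smul (lam : k) (T : A →ₗ[k] A) {n : ℕ} (f : Coch k A M n) (v : ℕ → A) :
    f (trunc n fun i => T (v i) + lam • v i) = f (trunc n fun i => T (v i)) +
      lam • ∑ j ∈ Finset.range n, f (trunc n (stair lam T j v)) := by
  -- The hybrids: `T` in the first `j` places, `T + lam` in the others.
  let w : ℕ → ℕ → A := fun j i => if i < j then T (v i) else T (v i) + lam • v i
  have h0 : trunc n (w 0) = trunc n fun i => T (v i) + lam • v i := by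
    funext i; simp [w]
  have hn : trunc n (w n) = trunc n fun i => T (v i) := by
    funext i; simp [w]
  have hstep : ∀ j ∈ Finset.range n, lam • f (trunc n (stair lam T j v)) =
      f (trunc n (w j)) - f (trunc n (w (j + 1))) := by
    intro j hj
    rw [Finset.mem_range] at hj
    have hu : ∀ (u : ℕ → A), (∀ i, i ≠ j → u i = stair lam T j v i) →
        trunc n u = Function.update (trunc n (stair lam T j v)) ⟨j, hj⟩ (u j) := by
      intro u h
      funext i
      simp only [trunc_apply, Function.update_apply, Fin.ext_iff]
      split_ifs with hi
      · rw [hi]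
      · exact h i hi
    rw [hu (w j) (by intro i hi; simp only [w, stair]; grind),
      hu (w (j + 1)) (by intro i hi; simp only [w, stair]; grind)]
    have hs : trunc n (stair lam T j v) =
        Function.update (trunc n (stair lam T j v)) ⟨j, hj⟩ (v j) := by
      conv_lhs => rw [hu (stair lam T j v) fun _ _ => rfl]
      simp [stair]
    simp only [w, lt_irrefl, if_false, Nat.lt_succ_self, if_true, f.map_update_add,
      f.map_update_smul, ← hs]
    abel
  rw [Finset.smul_sum, Finset.sum_congr rfl hstep, Finset.sum_range_sub', h0, hn]
  abel

/-- For `lam ≠ 0` both sides, multiplied by `lam`, equal `f((T + lam) v) - f(T v)`: one by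
multilinear expansion over subsets, the other by telescoping. For `lam = 0` only the subsets of size
`n - 1`, the complements of points, survive, and these are exactly the stairs. -/
theorem sum_proper_subsets (lam : k) (T : A →ₗ[k] A) {n : ℕ} (f : Coch k A M n) (v : ℕ → A) :
    ∑ j ∈ Finset.range n, lam ^ (n - j - 1) •
      ∑ S ∈ Finset.powersetCard j (Finset.univ : Finset (Fin n)),
        f (fun i => if i ∈ S then T (v i) else v i) =
    ∑ j ∈ Finset.range n, f (trunc n (stair lam T j v)) := by
  rcases eq_or_ne lam 0 with rfl | hlam
  · cases n with
    | zero => simp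
    | succ n =>
      rw [Finset.sum_range_succ, Finset.sum_eq_zero, zero_add]
      · rw [Finset.sum_range (fun j => f (trunc (n + 1) (stair 0 T j v)))]
        simp only [Nat.add_sub_cancel_left, Nat.sub_self, pow_zero, one_smul]
        symm
        refine Finset.sum_bij (fun j _ => {j}ᶜ) ?_ ?_ ?_ ?_
        · intro j _
          simp [Finset.mem_powersetCard, Finset.card_compl]
        · intro i _ j _ h
          simpa using h
        · intro S hS
          rw [Finset.mem_powersetCard] at hS
          obtain ⟨a, ha⟩ := Finset.card_eq_one.1
            (show Sᶜ.card = 1 by rw [Finset.card_compl, hS.2]; simp)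
          exact ⟨a, Finset.mem_univ _, by rw [← ha, compl_compl]⟩
        · intro j _
          congr 1
          funext i
          simp only [trunc_apply, stair, Finset.mem_compl, Finset.mem_singleton, Fin.ext_iff,
            zero_smul, add_zero]
          grind
      · intro j hj
        rw [Finset.mem_range] at hj
        rw [show n + 1 - j - 1 = (n - j - 1) + 1 by omega, pow_succ, mul_zero, zero_smul]
  · refine (IsUnit.smul_left_cancel (IsUnit.mk0 lam hlam)).1 ?_
    refine add_left_cancel (a := f (trunc n fun i => T (v i))) ?_
    rw [← apply_trunc_add_smul]
    have h1 := f.map_add_univ (trunc n fun i => T (v i)) (trunc n fun i => lam • v i)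
    rw [← Finset.powerset_univ, Finset.sum_powerset, Finset.card_univ, Fintype.card_fin,
      Finset.sum_range_succ] at h1
    -- In the expansion `S` is the set of places that receive `T v_i`; each of the remaining `n -
    -- |S|` places contributes a factor `lam`.
    have h2 : ∀ S : Finset (Fin n),
        f (S.piecewise (trunc n fun i => T (v i)) (trunc n fun i => lam • v i)) =
        lam ^ (n - S.card) • f (fun i => if i ∈ S then T (v i) else v i) := by
      intro S
      have := f.map_piecewise_smul (fun _ => lam) (fun i => if i ∈ S then T (v i) else v i) Sᶜ
      rw [Finset.prod_const, Finset.card_compl, Fintype.card_fin] at this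
      rw [← this]
      congr 1
      funext i
      by_cases hi : i ∈ S <;> simp [hi, Finset.piecewise]
    have h3 : (trunc n fun i => T (v i) + lam • v i) =
        (trunc n fun i => T (v i)) + trunc n fun i => lam • v i := rfl
    rw [h3, h1, add_comm]
    congr 1
    · rw [Finset.smul_sum]
      refine Finset.sum_congr rfl fun j hj => ?_
      rw [Finset.mem_range] at hj
      rw [smul_smul, ← pow_succ', show n - j - 1 + 1 = n - j by omega, Finset.smul_sum]
      refine Finset.sum_congr rfl fun S hS => ?_
      rw [h2, (Finset.mem_powersetCard.1 hS).2]
    · have : Finset.powersetCard n (Finset.univ : Finset (Fin n)) = {Finset.univ} := by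
        have := Finset.powersetCard_self (Finset.univ : Finset (Fin n))
        rwa [Finset.card_univ, Fintype.card_fin] at this
      rw [this, Finset.sum_singleton, Finset.piecewise_univ]

theorem Phi_apply (lam : k) (T : A →ₗ[k] A) (TM : M →ₗ[k] M) (n : ℕ) (f : Coch k A M n)
    (v : Fin n → A) :
    Phi lam T TM n f v = f (fun i => T (v i)) -
      ∑ j ∈ Finset.range n, lam ^ (n - j - 1) •
        ∑ S ∈ Finset.powersetCard j (Finset.univ : Finset (Fin n)),
          TM (f (fun i => if i ∈ S then T (v i) else v i)) := by
  have h : ∀ (S : Finset (Fin n)) i,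
      (if i ∈ S then T else LinearMap.id) (v i) = if i ∈ S then T (v i) else v i := fun S i => by
    split_ifs <;> rfl
  simp only [Phi, h, LinearMap.sub_apply, LinearMap.sum_apply, LinearMap.smul_apply,
    LinearMap.comp_apply, MultilinearMap.compLinearMapₗ_apply, sub_apply, sum_apply, smul_apply,
    MultilinearMap.compLinearMap_apply, LinearMap.compMultilinearMapₗ_apply,
    LinearMap.compMultilinearMap_apply]

theorem Phi_trunc (lam : k) (T : A →ₗ[k] A) (TM : M →ₗ[k] M) (n : ℕ) (f : Coch k A M n)
    (v : ℕ → A) :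
    Phi lam T TM n f (trunc n v) = f (trunc n fun i => T (v i)) -
      TM (∑ j ∈ Finset.range n, f (trunc n (stair lam T j v))) := by
  rw [Phi_apply, ← sum_proper_subsets]
  simp only [map_sum, map_smul]
  rfl

/-! ### Compatibility of `Φ` with the differentials, and the mapping cone -/

namespace IsRotaBaxterAlgebra

variable {lam : k} {mul : A →ₗ[k] A →ₗ[k] A} {T : A →ₗ[k] A}

/-- A stair whose step lies outside the contracted pair goes to a stair, since `T` and `T + lam` are
multiplicative from `⋆`. The two stairs with their step inside the pair merge into one. -/
theorem sum_stair_seqContract (hA : IsRotaBaxterAlgebra lam mul T) {n : ℕ} (f : Coch k A M n)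
    (v : ℕ → A) {i : ℕ} (hi : i < n) :
    ∑ j ∈ Finset.range (n + 1),
      f (trunc n (seqContract (fun x y => mul x y) i (stair lam T j v))) =
    ∑ j ∈ Finset.range n,
      f (trunc n (stair lam T j (seqContract (fun x y => starMul lam mul T x y) i v))) := by
  have hstar : ∀ a b, mul (T a + lam • a) (T b + lam • b) =
      T (starMul lam mul T a b) + lam • starMul lam mul T a b := fun a b => by
    rw [hA.map_starMul]
    simp only [starMul_apply, map_add, map_smul, LinearMap.add_apply, LinearMap.smul_apply,
      smul_add]
    abel
  have hlt : ∀ j, j < i → seqContract (fun x y => mul x y) i (stair lam T j v) =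
      stair lam T j (seqContract (fun x y => starMul lam mul T x y) i v) := fun j hj => by
    funext t
    simp only [seqContract, stair]
    grind
  have hgt : ∀ j, i < j → seqContract (fun x y => mul x y) i (stair lam T (j + 1) v) =
      stair lam T j (seqContract (fun x y => starMul lam mul T x y) i v) := fun j hj => by
    have := hA.map_starMul
    funext t
    simp only [seqContract, stair]
    grind
  -- The two sequences differ only in place `i`, with entries `v_i (T + lam) v_{i+1}` and `T(v_i)
  -- v_{i+1}`, whose sum is `v_i ⋆ v_{i+1}`.
  have heq : f (trunc n (seqContract (fun x y => mul x y) i (stair lam T i v))) +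
      f (trunc n (seqContract (fun x y => mul x y) i (stair lam T (i + 1) v))) =
      f (trunc n (stair lam T i (seqContract (fun x y => starMul lam mul T x y) i v))) := by
    have hu : ∀ (u : ℕ → A), (∀ t, t ≠ i → u t =
        stair lam T i (seqContract (fun x y => starMul lam mul T x y) i v) t) →
        trunc n u = Function.update (trunc n (stair lam T i
          (seqContract (fun x y => starMul lam mul T x y) i v))) ⟨i, hi⟩ (u i) := by
      intro u h
      funext t
      simp only [trunc_apply, Function.update_apply, Fin.ext_iff]
      split_ifs with ht
      · rw [ht]
      · exact h t ht
    rw [hu _ (by intro t ht; simp only [seqContract, stair]; grind),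
      hu (seqContract (fun x y => mul x y) i (stair lam T (i + 1) v))
        (by intro t ht; simp only [seqContract, stair]; grind), ← f.map_update_add]
    conv_rhs => rw [hu (stair lam T i _) fun _ _ => rfl]
    congr 2
    simp only [seqContract, stair, lt_irrefl, if_false, if_true, Nat.lt_succ_self,
      (Nat.lt_succ_self i).not_gt, starMul_apply, map_add, map_smul, Nat.succ_ne_self]
    abel
  obtain ⟨c, rfl⟩ : ∃ c, n = i + (c + 1) := ⟨n - i - 1, by omega⟩
  rw [show i + (c + 1) + 1 = i + (c + 1 + 1) by omega, Finset.sum_range_add,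
    Finset.sum_range_add _ i (c + 1),
    Finset.sum_range_succ' _ c, Finset.sum_range_succ' _ (c + 1), Finset.sum_range_succ' _ c]
  rw [add_assoc (∑ _ ∈ _, _),
    add_comm (f (trunc _ (seqContract _ i (stair lam T (i + (0 + 1)) v))))]
  congr 1
  · exact Finset.sum_congr rfl fun j hj => by rw [hlt j (Finset.mem_range.1 hj)]
  · congr 1
    exact Finset.sum_congr rfl fun j hj => by
      rw [← hgt (i + (j + 1)) (by omega)]
      rfl

/-- `Φ` is a chain map. -/
theorem Phi_comp_hochDiff (hA : IsRotaBaxterAlgebra lam mul T) (n : ℕ) :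
    Phi lam T T (n + 1) ∘ₗ hochDiff mul mul mul n =
      rboDiff lam mul T T mul mul n ∘ₗ Phi lam T T n := by
  refine LinearMap.ext fun f => ext_trunc fun v => ?_
  have hleft : ∀ j, f (trunc n fun i => stair lam T (j + 1) v (i + 1)) =
      f (trunc n (stair lam T j fun i => v (i + 1))) := fun j => by
    congr 1
    funext i
    simp [stair]
  have hleft0 : f (trunc n fun i => stair lam T 0 v (i + 1)) =
      f (trunc n fun i => T (v (i + 1)) + lam • v (i + 1)) := by
    congr 1
  have hright : ∀ j ∈ Finset.range n, stair lam T j v n = T (v n) + lam • v n := fun j hj => by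
    rw [Finset.mem_range] at hj
    simp only [stair]
    grind
  have hrightn : f (trunc n (stair lam T n v)) = f (trunc n fun i => T (v i)) := by
    congr 1
    funext i
    simp [stair]
  have hmid : ∀ j, seqContract (fun x y => mul x y) j (fun i => T (v i)) =
      fun i => T (seqContract (fun x y => starMul lam mul T x y) j v i) := fun j => by
    have := hA.map_starMul
    funext i
    simp only [seqContract]
    grind
  -- In the stair at `0` the remaining arguments are all hit by `T + lam`, so telescoping applies to
  -- them; the other stairs begin with `T v_0`.
  have hL : ∑ j ∈ Finset.range (n + 1), mul (stair lam T j v 0)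
      (f (trunc n fun i => stair lam T j v (i + 1))) =
      mul (T (v 0)) (∑ j ∈ Finset.range n, f (trunc n (stair lam T j fun i => v (i + 1)))) +
      mul (v 0) (f (trunc n fun i => T (v (i + 1))) +
        lam • ∑ j ∈ Finset.range n, f (trunc n (stair lam T j fun i => v (i + 1)))) := by
    rw [Finset.sum_range_succ', ← apply_trunc_add_smul lam T f fun i => v (i + 1), hleft0]
    simp only [hleft, map_sum]
    rfl
  have hR : ∑ j ∈ Finset.range (n + 1), mul (f (trunc n (stair lam T j v))) (stair lam T j v n) =
      mul (∑ j ∈ Finset.range n, f (trunc n (stair lam T j v))) (T (v n) + lam • v n) +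
      mul (f (trunc n fun i => T (v i))) (v n) := by
    rw [Finset.sum_range_succ, hrightn, Finset.sum_congr rfl fun j hj => by rw [hright j hj]]
    simp only [map_sum, LinearMap.sum_apply]
    simp [stair]
  have hM : ∑ j ∈ Finset.range (n + 1), ∑ i ∈ Finset.range n, (-1 : k) ^ (n - i) •
      f (trunc n (seqContract (fun x y => mul x y) i (stair lam T j v))) =
      ∑ i ∈ Finset.range n, (-1 : k) ^ (n - i) • ∑ j ∈ Finset.range n,
      f (trunc n (stair lam T j (seqContract (fun x y => starMul lam mul T x y) i v))) := by
    rw [Finset.sum_comm]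
    refine Finset.sum_congr rfl fun i hi => ?_
    rw [← Finset.smul_sum, hA.sum_stair_seqContract f v (Finset.mem_range.1 hi)]
  rw [LinearMap.comp_apply, LinearMap.comp_apply, Phi_trunc, rboDiff, hochDiff_trunc]
  simp only [hochDiff_trunc, Phi_trunc, Finset.sum_add_distrib, hM, hR, ← Finset.smul_sum, hL,
    hmid]
  -- The middle terms already agree. What is left concerns only the outer terms and is the
  -- Rota-Baxter identity for `v_0, u` and for `u', v_n`.
  generalize f (trunc n fun i => T (v (i + 1))) = p
  generalize ∑ j ∈ Finset.range n, f (trunc n (stair lam T j fun i => v (i + 1))) = u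
  generalize f (trunc n fun i => T (v i)) = p'
  generalize ∑ j ∈ Finset.range n, f (trunc n (stair lam T j v)) = u'
  simp only [smul_sub, Finset.sum_sub_distrib, leftAct_apply, rightAct_apply, map_sub, map_add,
    map_smul, map_sum, LinearMap.sub_apply, hA.rotaBaxter, smul_add]
  abel

/-- The negative shift of the mapping cone of `Φ` is a complex. -/
theorem rbaDiff_comp_rbaDiff (hA : IsRotaBaxterAlgebra lam mul T) (n : ℕ) :
    rbaDiff lam mul T T mul mul (n + 1) ∘ₗ rbaDiff lam mul T T mul mul n = 0 := by
  have hδ : ∀ n f, hochDiff mul mul mul (n + 1) (hochDiff mul mul mul n f) = 0 := fun n f =>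
    LinearMap.congr_fun (hochDiff_comp_hochDiff mul mul mul hA.assoc hA.assoc hA.assoc
      hA.assoc n) f
  have hd : ∀ n f, rboDiff lam mul T T mul mul (n + 1) (rboDiff lam mul T T mul mul n f) = 0 :=
    fun n f => LinearMap.congr_fun (hA.rboDiff_comp_rboDiff n) f
  have hΦ : ∀ n f, Phi lam T T (n + 1) (hochDiff mul mul mul n f) =
      rboDiff lam mul T T mul mul n (Phi lam T T n f) :=
    fun n f => LinearMap.congr_fun (hA.Phi_comp_hochDiff n) f
  cases n with
  | zero =>
    refine LinearMap.ext fun (f : Coch k A A 0) => Prod.ext (hδ 0 f) ?_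
    change -rboDiff lam mul T T mul mul 0 (-(Phi lam T T 0 f)) -
      Phi lam T T 1 (hochDiff mul mul mul 0 f) = 0
    rw [hΦ, map_neg, neg_neg, sub_self]
  | succ n =>
    refine LinearMap.ext fun (x : Coch k A A (n + 1) × Coch k A A n) =>
      Prod.ext (hδ (n + 1) x.1) ?_
    change -rboDiff lam mul T T mul mul (n + 1) (-rboDiff lam mul T T mul mul n x.2 -
      Phi lam T T (n + 1) x.1) - Phi lam T T (n + 2) (hochDiff mul mul mul (n + 1) x.1) = 0
    rw [hΦ, map_sub, map_neg, hd]
    abel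

end IsRotaBaxterAlgebra

end Classical

section Graded

variable {k : Type*} [Field k] {B C : Type*} [AddCommGroup B] [Module k B]
  [AddCommGroup C] [Module k C]

/-! ### Evaluation of elements of a direct sum of spaces of multilinear maps -/

/-- The evaluation of the component in `Hom(B^{⊗ N}, C)` at the first `N` terms of a sequence. -/
def evalSeq (N : ℕ) (v : ℕ → B) :
    (⨁ n, MultilinearMap k (fun _ : Fin n => B) C) →ₗ[k] C where
  toFun X := X N (trunc N v)
  map_add' X Y := by rw [DirectSum.add_apply, add_apply]
  map_smul' c X := by
    rw [DirectSum.smul_apply, smul_apply, RingHom.id_apply]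

theorem evalSeq_apply (N : ℕ) (v : ℕ → B) (X : ⨁ n, MultilinearMap k (fun _ : Fin n => B) C) :
    evalSeq N v X = X N (trunc N v) := rfl

theorem evalSeq_lof (N : ℕ) (v : ℕ → B) (i : ℕ) (f : MultilinearMap k (fun _ : Fin i => B) C) :
    evalSeq N v (DirectSum.lof k ℕ (fun n => MultilinearMap k (fun _ : Fin n => B) C) i f) =
      if i = N then f (trunc i v) else 0 := by
  rw [evalSeq_apply]
  split_ifs with h
  · subst h
    rw [DirectSum.lof_apply]
  · rw [DirectSum.lof_eq_of, DirectSum.of_eq_of_ne _ _ _ (Ne.symm h), zero_apply]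

theorem ext_evalSeq {X Y : ⨁ n, MultilinearMap k (fun _ : Fin n => B) C}
    (h : ∀ N v, evalSeq N v X = evalSeq N v Y) : X = Y :=
  DFinsupp.ext fun N => ext_trunc fun v => h N v

theorem evalSeq_units_smul (N : ℕ) (v : ℕ → B) (u : ℤˣ)
    (X : ⨁ n, MultilinearMap k (fun _ : Fin n => B) C) :
    evalSeq N v (u • X) = u • evalSeq N v X := by
  rw [Units.smul_def, Units.smul_def, map_zsmul]

/-! ### Compositions and braces -/

variable {A : Type*} [AddCommGroup A] [Module k A]

theorem desuspTotal_eq (N : ℕ) (v : ℕ → Susp A) (X : ⨁ n, CAlg k A n) :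
    evalSeq N v (desuspTotal k A X) = (susp k A).symm (evalSeq N v X) := by
  have : evalSeq N v ∘ₗ desuspTotal k A = (susp k A).symm.toLinearMap ∘ₗ evalSeq N v := by
    refine DirectSum.linearMap_ext k fun i => LinearMap.ext fun f => ?_
    simp only [desuspTotal, LinearMap.comp_apply, DirectSum.toModule_lof, evalSeq_lof]
    split_ifs
    · rfl
    · rw [map_zero]
  exact LinearMap.congr_fun this X

/-- The entry in place `t` reads the block that starts after the arguments of all earlier entries.
-/
theorem tensComp_trunc {n : ℕ} (F : CAlg k A n) (w : Fin n → AlgElt k A) (v : ℕ → Susp A) :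
    tensComp F w (trunc _ v) =
      (∑ t, (1 - ((w t).1 : ℤ)) *
        ∑ t' ∈ Finset.univ.filter (· < t), ((w t').1 : ℤ)).negOnePow •
      F fun t => (w t).2 (trunc _ fun i =>
        v (∑ t' ∈ Finset.univ.filter (· < t), (w t').1 + i)) := by
  rw [tensComp, Units.smul_def, Units.smul_def, smul_apply]
  refine congrArg (_ • F ·) (funext fun t => ?_)
  congr 1
  funext i
  change v (finSigmaFinEquiv (⟨t, i⟩ : (t : Fin n) × Fin ((w t).1))) = v _
  rw [finSigmaFinEquiv_apply]
  congr 2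
  refine Finset.sum_bij (fun a _ => Fin.castLE t.2.le a) ?_ ?_ ?_ ?_
  · intro a _
    exact Finset.mem_filter.2 ⟨Finset.mem_univ _, a.2⟩
  · intro a _ b _ h
    simpa [Fin.ext_iff] using h
  · intro b hb
    simp only [Finset.mem_filter, Finset.mem_univ, true_and, Fin.lt_def] at hb
    exact ⟨⟨b, hb⟩, Finset.mem_univ _, rfl⟩
  · intro a _
    rfl

theorem slots_apply {m r : ℕ} (e : Fin r ↪o Fin m) (G : Fin r → AlgElt k A) (i : Fin r) :
    slots e G (e i) = G i := by
  have h : ∃ j, e j = e i := ⟨i, rfl⟩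
  rw [slots, dif_pos h, e.injective h.choose_spec]

theorem slots_of_forall_ne {m r : ℕ} (e : Fin r ↪o Fin m) (G : Fin r → AlgElt k A) {t : Fin m}
    (ht : ∀ i, e i ≠ t) : slots e G t = idElt := by
  rw [slots, dif_neg (by simpa using ht)]

/-- A linear endomorphism of `sA`, as an element of `𝔠_Alg(A)`. -/
def linElt (θ : Susp A →ₗ[k] Susp A) : AlgElt k A :=
  ⟨1, MultilinearMap.ofSubsingleton k (Susp A) (Susp A) 0 θ⟩

theorem linElt_eval {w : AlgElt k A} {θ : Susp A →ₗ[k] Susp A} (h : w = linElt θ)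
    (u : ℕ → Susp A) : w.2 (trunc w.1 u) = θ (u 0) := by
  subst h
  rfl

/-- Unary entries have degree `0`, so no Koszul sign appears and every block is a single argument.
-/
theorem evalSeq_tensComp_lin {n : ℕ} (F : CAlg k A n) (w : Fin n → AlgElt k A)
    (θ : Fin n → Susp A →ₗ[k] Susp A) (h : ∀ t, w t = linElt (θ t)) (N : ℕ) (v : ℕ → Susp A) :
    evalSeq N v (DirectSum.lof k ℕ (CAlg k A) _ (tensComp F w)) =
      if n = N then F (fun t => θ t (v t)) else 0 := by
  have h1 : ∀ t, (w t).1 = 1 := fun t => by rw [h t]; rfl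
  rw [evalSeq_lof, tensComp_trunc]
  simp only [fun t => linElt_eval (h t), h1, Finset.sum_const, Finset.card_univ,
    Fintype.card_fin, smul_eq_mul, mul_one, Nat.cast_one, sub_self, zero_mul, smul_zero,
    Int.negOnePow_zero, one_smul, add_zero]
  have hc : ∀ t : Fin n, (Finset.univ.filter (· < t)).card = t := fun t => by
    rw [← Fin.card_Iio t]
    congr 1
    ext
    simp
  simp only [hc]

/-- Increasing embeddings correspond to their images, so inserting `r` copies of one operator is a
sum over `r`-element subsets. This is the source of the subset sums in `Φ`. -/
theorem evalSeq_brace_lin {n r : ℕ} (F : CAlg k A n) (θ : Susp A →ₗ[k] Susp A) (N : ℕ)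
    (v : ℕ → Susp A) :
    evalSeq N v (brace F fun _ : Fin r => linElt θ) =
      if n = N then ∑ S ∈ Finset.powersetCard r (Finset.univ : Finset (Fin n)),
        F (fun t => if t ∈ S then θ (v t) else v t) else 0 := by
  rw [brace, map_sum]
  have h : ∀ (e : Fin r ↪o Fin n) (t : Fin n), slots e (fun _ => linElt θ) t =
      linElt (if t ∈ Finset.univ.map e.toEmbedding then θ else LinearMap.id) := by
    intro e t
    split_ifs with ht
    · obtain ⟨i, _, rfl⟩ := Finset.mem_map.1 ht
      exact slots_apply e _ i
    · exact slots_of_forall_ne e _ fun i hi => ht (Finset.mem_map.2 ⟨i, Finset.mem_univ _, hi⟩)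
  simp only [fun e => evalSeq_tensComp_lin F _ _ (h e) N v]
  split_ifs
  · refine Finset.sum_bij (fun e _ => Finset.univ.map e.toEmbedding) ?_ ?_ ?_ ?_
    · intro e _
      simp [Finset.mem_powersetCard]
    · intro e _ e' _ he
      have : Set.range e = Set.range e' := by
        simpa using congrArg (fun S : Finset (Fin n) => (S : Set (Fin n))) he
      exact DFunLike.coe_injective ((e.strictMono.range_inj e'.strictMono).1 this)
    · intro S hS
      have hc := (Finset.mem_powersetCard.1 hS).2
      refine ⟨S.orderEmbOfFin hc, Finset.mem_univ _, ?_⟩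
      ext
      simp
    · intro e _
      congr 1
      funext t
      split_ifs <;> rfl
  · exact Finset.sum_const_zero

/-- The sequence `v_0, …, v_{j-1}, G(v_j, …, v_{j+q-1}), v_{j+q}, …`. -/
def insertSeq {q : ℕ} (G : MultilinearMap k (fun _ : Fin q => B) B) (j : ℕ) (v : ℕ → B) : ℕ → B :=
  fun t => if t < j then v t else if t = j then G (trunc q fun i => v (j + i)) else v (t + q - 1)

/-- The inserted `G` has degree `1 - q` and passes `j` arguments of degree `1`; the identities in
the other places contribute no sign. -/
theorem evalSeq_brace_one {n q : ℕ} (F : CAlg k A n) (G : CAlg k A q) (N : ℕ)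
    (v : ℕ → Susp A) :
    evalSeq N v (brace F fun _ : Fin 1 => ⟨q, G⟩) =
      if N + 1 = n + q then ∑ j ∈ Finset.range n,
        ((1 - (q : ℤ)) * j).negOnePow • F (trunc n (insertSeq G j v)) else 0 := by
  have hb : Function.Bijective fun e : Fin 1 ↪o Fin n => e 0 := by
    refine ⟨fun e e' h => ?_, fun t => ⟨OrderEmbedding.ofStrictMono (fun _ => t)
      (Subsingleton.strictMono _), rfl⟩⟩
    ext i
    rw [Subsingleton.elim i 0]
    exact congrArg _ h
  let w : Fin n → Fin n → AlgElt k A := fun j t => if t = j then ⟨q, G⟩ else idElt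
  have hw : ∀ e : Fin 1 ↪o Fin n, slots e (fun _ => ⟨q, G⟩) = w (e 0) := by
    intro e
    funext t
    simp only [w]
    split_ifs with ht
    · rw [ht, slots_apply]
    · refine slots_of_forall_ne e _ fun i => ?_
      rw [Subsingleton.elim i 0]
      exact Ne.symm ht
  -- Before place `t` there are `t` entries, each of arity `1` except `G`, of arity `q`. The extra
  -- summand on the left avoids truncated subtraction when `q = 0`.
  have hcard : ∀ j t : Fin n, ∑ t' ∈ Finset.univ.filter (· < t), (w j t').1 +
      (if j < t then 1 else 0) = t + if j < t then q else 0 := by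
    intro j t
    have h1 : ∑ t' ∈ Finset.univ.filter (· < t), (w j t').1 +
        ∑ t' ∈ Finset.univ.filter (· < t), (if t' = j then 1 else 0) =
        ∑ t' ∈ Finset.univ.filter (· < t), 1 +
          ∑ t' ∈ Finset.univ.filter (· < t), (if t' = j then q else 0) := by
      rw [← Finset.sum_add_distrib, ← Finset.sum_add_distrib]
      refine Finset.sum_congr rfl fun t' _ => ?_
      simp only [w]
      split_ifs
      · exact add_comm _ _
      · rfl
    have h2 : (Finset.univ.filter (· < t)).card = t := by
      rw [← Fin.card_Iio t]
      congr 1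
      ext
      simp
    simpa [Finset.sum_ite_eq', h2] using h1
  have htot : ∀ j : Fin n, ∑ t, (w j t).1 + 1 = n + q := by
    intro j
    have h1 : ∑ t, (w j t).1 + ∑ t, (if t = j then 1 else 0) =
        ∑ t : Fin n, 1 + ∑ t, (if t = j then q else 0) := by
      rw [← Finset.sum_add_distrib, ← Finset.sum_add_distrib]
      refine Finset.sum_congr rfl fun t' _ => ?_
      simp only [w]
      split_ifs
      · exact add_comm _ _
      · rfl
    simpa using h1
  have hsign : ∀ j : Fin n, (∑ t, (1 - ((w j t).1 : ℤ)) *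
      ∑ t' ∈ Finset.univ.filter (· < t), ((w j t').1 : ℤ)) = (1 - (q : ℤ)) * (j : ℕ) := by
    intro j
    rw [Finset.sum_eq_single j]
    · have := hcard j j
      simp only [lt_irrefl, if_false, add_zero] at this
      rw [← Nat.cast_sum, this]
      simp [w]
    · intro t _ ht
      have : (w j t).1 = 1 := by simp [w, ht, idElt]
      rw [this]
      simp
    · simp
  have hval : ∀ j : Fin n, (fun t => (w j t).2 (trunc _ fun i =>
        v (∑ t' ∈ Finset.univ.filter (· < t), (w j t').1 + i))) =
      trunc n (insertSeq G j v) := by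
    intro j
    funext t
    have hc := hcard j t
    generalize ∑ t' ∈ Finset.univ.filter (· < t), (w j t').1 = c at hc
    simp only [trunc_apply, insertSeq, Fin.lt_def] at hc ⊢
    rcases lt_trichotomy (t : ℕ) j with h | h | h
    · have hw' : w j t = linElt LinearMap.id := by
        simp only [w]
        rw [if_neg (by rintro rfl; omega)]
        rfl
      rw [linElt_eval hw', if_pos h]
      rw [if_neg (by omega), if_neg (by omega)] at hc
      simp only [LinearMap.id_apply]
      congr 1
    · obtain rfl : t = j := Fin.ext h
      rw [if_neg (by omega), if_neg (by omega)] at hc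
      have hw' : w t t = ⟨q, G⟩ := if_pos rfl
      rw [hw']
      simp only [lt_irrefl, if_false, if_true]
      obtain rfl : c = t := by omega
      rfl
    · have hw' : w j t = linElt LinearMap.id := by
        simp only [w]
        rw [if_neg (by rintro rfl; omega)]
        rfl
      rw [linElt_eval hw', if_neg (by omega), if_neg (by omega)]
      rw [if_pos h, if_pos h] at hc
      simp only [LinearMap.id_apply]
      congr 1
      omega
  have key : ∀ j : Fin n, evalSeq N v (DirectSum.lof k ℕ (CAlg k A) _ (tensComp F (w j))) =
      if N + 1 = n + q then ((1 - (q : ℤ)) * (j : ℕ)).negOnePow •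
        F (trunc n (insertSeq G j v)) else 0 := by
    intro j
    rw [evalSeq_lof, tensComp_trunc, hsign, hval]
    have := htot j
    refine if_congr (by omega) rfl rfl
  rw [brace, map_sum, Finset.sum_range, Fintype.sum_bijective _ hb _ (fun j : Fin n =>
    if N + 1 = n + q then ((1 - (q : ℤ)) * (j : ℕ)).negOnePow • F (trunc n (insertSeq G j v)) else 0)
    fun e => by rw [hw e]; exact key (e 0)]
  split_ifs
  · rfl
  · exact Finset.sum_const_zero

theorem brace_zero_left {n r : ℕ} (G : Fin r → AlgElt k A) : brace (0 : CAlg k A n) G = 0 := by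
  refine Finset.sum_eq_zero fun e _ => ?_
  have : tensComp 0 (slots e G) = 0 :=
    ext_trunc fun v => by rw [tensComp_trunc, zero_apply, smul_zero, zero_apply]
  rw [this, map_zero]

theorem tensComp_eq_zero {n : ℕ} (F : CAlg k A n) (w : Fin n → AlgElt k A) {t : Fin n}
    (h : (w t).2 = 0) : tensComp F w = 0 := by
  refine ext_trunc fun v => ?_
  rw [tensComp_trunc, F.map_coord_zero t, smul_zero, zero_apply]
  rw [h, zero_apply]

theorem brace_eq_zero {n r : ℕ} (F : CAlg k A n) (G : Fin r → AlgElt k A) {i : Fin r}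
    (h : (G i).2 = 0) : brace F G = 0 := by
  refine Finset.sum_eq_zero fun e _ => ?_
  rw [tensComp_eq_zero F (slots e G) (t := e i) (by rw [slots_apply, h]), map_zero]

theorem braceOne_zero_left {n : ℕ} (X : ⨁ n, CAlg k A n) : braceOne (0 : CAlg k A n) X = 0 :=
  Finset.sum_eq_zero fun _ _ => brace_zero_left _

@[simp]
theorem braceOne_zero_right {n : ℕ} (F : CAlg k A n) : braceOne F 0 = 0 := by
  simp [braceOne]

-- The condition on `H` is needed because the support is empty when `b = 0`.
open Classical in
theorem sum_support_lof {β : ℕ → Type*} [∀ n, AddCommGroup (β n)] [∀ n, Module k (β n)]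
    {D : Type*} [AddCommGroup D] (H : ∀ n, β n → D) (i : ℕ) (b : β i) (h : b = 0 → H i b = 0) :
    ∑ n ∈ DFinsupp.support (DirectSum.lof k ℕ β i b), H n (DirectSum.lof k ℕ β i b n) = H i b := by
  rw [Finset.sum_eq_single i]
  · rw [DirectSum.lof_apply]
  · intro n hn hni
    rw [DFinsupp.mem_support_iff, DirectSum.lof_eq_of, DirectSum.of_eq_of_ne _ _ _ hni] at hn
    exact absurd rfl hn
  · intro hi
    rw [DFinsupp.notMem_support_iff, DirectSum.lof_apply] at hi
    rw [DirectSum.lof_apply, h hi]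

theorem braceOne_lof {n q : ℕ} (F : CAlg k A n) (G : CAlg k A q) :
    braceOne F (DirectSum.lof k ℕ (CAlg k A) q G) = brace F fun _ : Fin 1 => ⟨q, G⟩ :=
  sum_support_lof (fun n b => brace F fun _ : Fin 1 => ⟨n, b⟩) q G
    fun h => brace_eq_zero F _ (i := 0) h

/-- A unary map has only one place for an insertion, so the brace is composition with it. -/
theorem evalSeq_braceOne_lin (θ : Susp A →ₗ[k] Susp A) (X : ⨁ n, CAlg k A n) (N : ℕ)
    (v : ℕ → Susp A) :
    evalSeq N v (braceOne (MultilinearMap.ofSubsingleton k (Susp A) (Susp A) (0 : Fin 1) θ) X) =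
      θ (evalSeq N v X) := by
  classical
  rw [braceOne, map_sum]
  simp only [evalSeq_brace_one]
  rw [Finset.sum_eq_single N]
  · rw [if_pos (add_comm _ _), Finset.sum_range_one, Nat.cast_zero, mul_zero,
      Int.negOnePow_zero, one_smul, evalSeq_apply]
    simp [insertSeq]
  · intro n _ hn
    exact if_neg (by omega)
  · intro hN
    rw [DFinsupp.notMem_support_iff] at hN
    rw [if_pos (add_comm _ _), Finset.sum_range_one, Nat.cast_zero, mul_zero,
      Int.negOnePow_zero, one_smul]
    simp [insertSeq, hN]

end Graded

section Graded

variable {k : Type*} [Field k] {A : Type*} [AddCommGroup A] [Module k A]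

/-! ### Signs -/

theorem negOnePow_smul {C : Type*} [AddCommGroup C] [Module k C] {z : ℤ} {n : ℕ}
    (h : Even (z - n)) (x : C) : z.negOnePow • x = (-1 : k) ^ n • x := by
  rw [(Int.negOnePow_eq_iff z n).2 h, Int.negOnePow_def, zpow_natCast, Units.smul_def]
  rcases Nat.even_or_odd n with hn | hn
  · rw [hn.neg_one_pow, hn.neg_one_pow]
    simp
  · rw [hn.neg_one_pow, hn.neg_one_pow]
    simp

/-! ### The identifications of the components with spaces of cochains -/

/-- The inverse of `tilde`. -/
def untilde (n : ℕ) : Coch k A A n →ₗ[k] CAlg k A n :=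
  suspOut n ∘ₗ MultilinearMap.compLinearMapₗ (fun _ : Fin n => (susp k A).symm.toLinearMap)

/-- The inverse of `hat`. -/
def unhat (n : ℕ) : Coch k A A n →ₗ[k] CRBO k A n :=
  MultilinearMap.compLinearMapₗ (fun _ : Fin n => (susp k A).symm.toLinearMap)

theorem tilde_untilde (n : ℕ) (f : Coch k A A n) : tilde n (untilde n f) = f := rfl

theorem hat_unhat (n : ℕ) (f : Coch k A A n) : hat n (unhat n f) = f := rfl

theorem ext_evalSeq_susp {C : Type*} [AddCommGroup C] [Module k C]
    {X Y : ⨁ n, MultilinearMap k (fun _ : Fin n => Susp A) C}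
    (h : ∀ N (u : ℕ → A), evalSeq N (fun i => susp k A (u i)) X =
      evalSeq N (fun i => susp k A (u i)) Y) : X = Y :=
  ext_evalSeq fun N v => h N fun i => (susp k A).symm (v i)

/-- The operator `s ∘ T ∘ s⁻¹` on `sA`. -/
def suspConj (T : A →ₗ[k] A) : Susp A →ₗ[k] Susp A :=
  (susp k A).toLinearMap ∘ₗ T ∘ₗ (susp k A).symm.toLinearMap

/-- The element `τ = T ∘ s⁻¹` of `𝔠_RBO(A)`. -/
def tauElt (T : A →ₗ[k] A) : Σ p, CRBO k A p :=
  ⟨1, MultilinearMap.ofSubsingleton k (Susp A) A 0 (T ∘ₗ (susp k A).symm.toLinearMap)⟩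

theorem mcAlg_trunc (mul : A →ₗ[k] A →ₗ[k] A) (u : ℕ → A) :
    mcAlg mul (trunc 2 fun i => susp k A (u i)) = susp k A (mul (u 0) (u 1)) := rfl

theorem trunc_insertSeq_mcAlg (mul : A →ₗ[k] A →ₗ[k] A) (n j : ℕ) (u : ℕ → A) :
    trunc n (insertSeq (mcAlg mul) j fun i => susp k A (u i)) =
      trunc n fun i => susp k A (seqContract (fun x y => mul x y) j u i) := by
  funext t
  simp only [trunc_apply, insertSeq, seqContract]
  split_ifs
  · rfl
  · rfl
  · rw [Nat.add_sub_assoc (by norm_num)]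

/-! ### Special braces -/

theorem brace_mcAlg_empty (mul : A →ₗ[k] A →ₗ[k] A) (G : Fin 0 → AlgElt k A) :
    brace (mcAlg mul) G = DirectSum.lof k ℕ (CAlg k A) 2 (mcAlg mul) := by
  rw [Subsingleton.elim G fun _ => linElt 0]
  refine ext_evalSeq fun N v => ?_
  rw [evalSeq_brace_lin, evalSeq_lof]
  simp
  rfl

/-- The result is again of the form `mcAlg` of a bilinear product, namely `a T(b) + T(a) b`, so it
can be inserted into other maps by the formula for a product. -/
theorem brace_mcAlg_linElt (mul : A →ₗ[k] A →ₗ[k] A) (T : A →ₗ[k] A) :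
    brace (mcAlg mul) (fun _ : Fin 1 => linElt (suspConj T)) =
      DirectSum.lof k ℕ (CAlg k A) 2 (mcAlg (mul.compl₂ T + mul ∘ₗ T)) := by
  refine ext_evalSeq_susp fun N u => ?_
  rw [evalSeq_brace_lin, evalSeq_lof, mcAlg_trunc]
  refine if_congr Iff.rfl ?_ rfl
  rw [Finset.powersetCard_one, Finset.sum_map, Fin.sum_univ_two, add_comm]
  rfl

/-- `m{sg}` for the product `m` and `g ∈ Hom((sA)^{⊗ p}, A)`. -/
theorem evalSeq_brace_mcAlg (mul : A →ₗ[k] A →ₗ[k] A) {p : ℕ} (G : CAlg k A p) (N : ℕ)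
    (u : ℕ → A) :
    evalSeq N (fun i => susp k A (u i)) (brace (mcAlg mul) fun _ : Fin 1 => ⟨p, G⟩) =
      if p + 1 = N then susp k A (mul (tilde p G (trunc p u)) (u p) +
        (-1 : k) ^ (p + 1) • mul (u 0) (tilde p G (trunc p fun i => u (i + 1)))) else 0 := by
  rw [evalSeq_brace_one]
  refine if_congr (by omega) ?_ rfl
  rw [Finset.sum_range_succ, Finset.sum_range_one, map_add, map_smul]
  rw [Nat.cast_zero, mul_zero, Int.negOnePow_zero, one_smul,
    negOnePow_smul (k := k) (n := p + 1) ⟨-p, by push_cast; ring⟩]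
  congr 1
  · change susp k A (mul _ _) = _
    simp [insertSeq, tilde, desuspOut, Nat.add_comm 1 p]
    rfl
  · congr 1
    change susp k A (mul _ _) = _
    simp [insertSeq, tilde, desuspOut, Nat.add_comm 1]
    rfl

/-- `F{m}` for the product `m`. -/
theorem evalSeq_brace_right_mcAlg (mul : A →ₗ[k] A →ₗ[k] A) {p : ℕ} (F : CAlg k A p) (N : ℕ)
    (u : ℕ → A) :
    evalSeq N (fun i => susp k A (u i)) (brace F fun _ : Fin 1 => ⟨2, mcAlg mul⟩) =
      if p + 1 = N then susp k A (∑ j ∈ Finset.range p, (-1 : k) ^ j •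
        tilde p F (trunc p (seqContract (fun x y => mul x y) j u))) else 0 := by
  rw [evalSeq_brace_one]
  refine if_congr (by omega) ?_ rfl
  rw [map_sum]
  refine Finset.sum_congr rfl fun j _ => ?_
  rw [negOnePow_smul (k := k) (n := j) ⟨-j, by push_cast; ring⟩, trunc_insertSeq_mcAlg, map_smul]
  rfl

/-! ### The Gerstenhaber bracket with the product -/

/-- `m{f}` gives the two outer terms of the Hochschild differential and `f{m}` the inner ones; as
`m` has degree `-1`, the signs match. -/
theorem gerst_mcAlg (mul : A →ₗ[k] A →ₗ[k] A) (X : ⨁ n, CAlg k A n) :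
    gerst (DirectSum.lof k ℕ (CAlg k A) 2 (mcAlg mul)) X =
      DirectSum.toModule k ℕ (⨁ n, CAlg k A n) (fun n => DirectSum.lof k ℕ (CAlg k A) (n + 1) ∘ₗ
        untilde (n + 1) ∘ₗ hochDiff mul mul mul n ∘ₗ tilde n) X := by
  classical
  rw [gerst, sum_support_lof (fun m (b : CAlg k A m) => ∑ n ∈ DFinsupp.support X,
    (brace b (fun _ : Fin 1 => (⟨n, X n⟩ : AlgElt k A)) -
      ((1 - (m : ℤ)) * (1 - (n : ℤ))).negOnePow •
        brace (X n) (fun _ : Fin 1 => (⟨m, b⟩ : AlgElt k A))))]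
  · conv_rhs => rw [← DirectSum.sum_support_of X, map_sum]
    refine Finset.sum_congr rfl fun n _ => ?_
    rw [← DirectSum.lof_eq_of k, DirectSum.toModule_lof]
    generalize X n = f
    refine ext_evalSeq_susp fun N u => ?_
    rw [map_sub, evalSeq_units_smul, evalSeq_brace_mcAlg, evalSeq_brace_right_mcAlg]
    simp only [LinearMap.comp_apply, evalSeq_lof]
    split_ifs with h
    · change _ = susp k A (hochDiff mul mul mul n (tilde n f) (trunc (n + 1) u))
      rw [hochDiff_trunc]
      rw [negOnePow_smul (k := k) (n := n + 1) ⟨-1, by push_cast; ring⟩, ← map_smul (susp k A),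
        ← map_sub]
      congr 1
      -- The signs `(-1)^{n-j}` of the Hochschild differential and `(-1)^{n+1+j}` of the bracket are
      -- opposite, which accounts for the minus sign in front of `f{m}`.
      have : ∑ j ∈ Finset.range n, (-1 : k) ^ (n - j) •
          tilde n f (trunc n (seqContract (fun x y => mul x y) j u)) =
          -((-1 : k) ^ (n + 1) • ∑ j ∈ Finset.range n, (-1 : k) ^ j •
          tilde n f (trunc n (seqContract (fun x y => mul x y) j u))) := by
        rw [Finset.smul_sum, ← Finset.sum_neg_distrib]
        refine Finset.sum_congr rfl fun j hj => ?_
        rw [Finset.mem_range] at hj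
        obtain ⟨c, rfl⟩ : ∃ c, n = j + c := ⟨n - j, by omega⟩
        rw [smul_smul, ← neg_smul, Nat.add_sub_cancel_left]
        congr 1
        have : (-1 : k) ^ j * (-1) ^ j = 1 := by rw [← mul_pow]; simp
        linear_combination (-(-1 : k) ^ c) * this
      rw [this]
      abel
    · simp
  · rintro h
    refine Finset.sum_eq_zero fun n _ => ?_
    rw [h, brace_zero_left, brace_eq_zero (X n) _ (i := 0) rfl, smul_zero, sub_zero]

/-! ### The mixed operations -/

theorem negOnePow_sum {ι : Type*} (s : Finset ι) (f : ι → ℤ) :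
    (∑ i ∈ s, f i).negOnePow = ∏ i ∈ s, (f i).negOnePow := by
  classical
  induction s using Finset.induction_on with
  | empty => simp
  | insert a s ha ih => rw [Finset.sum_insert ha, Finset.prod_insert ha, Int.negOnePow_add, ih]

/-- Elements of degree `-1` commute with Koszul sign `χ = 1`. -/
theorem chi_neg_one {r : ℕ} (σ : Equiv.Perm (Fin r)) : chi σ (fun _ => -((1 : ℕ) : ℤ)) = 1 := by
  rw [chi, σ.sign_eq_prod_prod_Ioi, negOnePow_sum, ← Finset.prod_mul_distrib]
  refine Finset.prod_eq_one fun i _ => ?_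
  have h : (Finset.Ioi i) = Finset.univ.filter (i < ·) := by
    ext
    simp
  rw [h, Finset.prod_filter, negOnePow_sum, ← Finset.prod_mul_distrib]
  refine Finset.prod_eq_one fun j _ => ?_
  -- Each inversion contributes `-1` to the sign of `σ` and `-1` to the Koszul sign.
  by_cases hij : i < j
  · have hne : σ i ≠ σ j := fun h => hij.ne (σ.injective h)
    by_cases hs : σ i < σ j
    · simp [hij, hs, hs.not_gt]
    · simp [hij, hs, lt_of_le_of_ne (not_lt.1 hs) hne.symm]
  · simp [hij]

/-- The bracket in the definition of the mixed operation, for the identity permutation. -/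
def opSummand (lam : k) {n m : ℕ} (sh : CAlg k A n) (w : Fin (m + 1) → Σ p, CRBO k A p) :
    ⨁ u, CRBO k A u :=
  (if h : m + 1 = n then
    desuspTotal k A (DirectSum.lof k ℕ (CAlg k A) _
      (tensComp (sh.domDomCongr (finCongr h.symm))
        (fun i => (⟨(w i).1, suspOut _ (w i).2⟩ : AlgElt k A))))
  else 0) -
  (if m + 1 ≤ n then
    ((1 - ((w 0).1 : ℤ)) * (1 - (n : ℤ))).negOnePow • lam ^ (n - (m + 1)) •
      desuspTotal k A (braceOne (suspOut _ (w 0).2)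
        (brace sh (fun i : Fin m => (⟨(w i.succ).1, suspOut _ (w i.succ).2⟩ : AlgElt k A))))
  else 0)

/-- The mixed operation, as a function of a family of elements of `𝔠_RBO(A)`. -/
def opFam (lam : k) {n m : ℕ} (sh : CAlg k A n) (w : Fin (m + 1) → Σ p, CRBO k A p) :
    ⨁ u, CRBO k A u :=
  opMixed lam sh (fun i => (w i).1) (fun i => (w i).2)

theorem opFam_eq (lam : k) {n m : ℕ} (sh : CAlg k A n) (w : Fin (m + 1) → Σ p, CRBO k A p) :
    opFam lam sh w = ∑ σ : Equiv.Perm (Fin (m + 1)),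
      (chi σ (fun i => -((w i).1 : ℤ)) *
        (((m : ℤ) + 1) * (1 - (n : ℤ)) +
        ∑ i : Fin m, ∑ j ∈ Finset.univ.filter (· ≤ i), -((w (σ j.castSucc)).1 : ℤ)).negOnePow) •
      opSummand lam sh (fun i => w (σ i)) := rfl

theorem opFam_eq_zero_of_summand (lam : k) {n m : ℕ} (sh : CAlg k A n)
    (w : Fin (m + 1) → Σ p, CRBO k A p)
    (h : ∀ σ : Equiv.Perm (Fin (m + 1)), opSummand lam sh (fun i => w (σ i)) = 0) :
    opFam lam sh w = 0 := by
  rw [opFam_eq]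
  exact Finset.sum_eq_zero fun σ _ => by rw [h, smul_zero]

theorem opFam_eq_zero_of_lt (lam : k) {n m : ℕ} (h : n < m + 1) (sh : CAlg k A n)
    (w : Fin (m + 1) → Σ p, CRBO k A p) : opFam lam sh w = 0 :=
  opFam_eq_zero_of_summand lam sh w fun σ => by
    rw [opSummand, dif_neg (by omega), if_neg (by omega), sub_zero]

theorem opFam_zero (lam : k) {n m : ℕ} (w : Fin (m + 1) → Σ p, CRBO k A p) :
    opFam lam (0 : CAlg k A n) w = 0 :=
  opFam_eq_zero_of_summand lam _ w fun σ => by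
    rw [opSummand, brace_zero_left, braceOne_zero_right, map_zero (desuspTotal k A), smul_zero,
      smul_zero,
      ite_self, sub_zero]
    split_ifs with h
    · subst h
      have : tensComp ((0 : CAlg k A (m + 1)).domDomCongr (finCongr rfl))
          (fun i => (⟨(w (σ i)).1, suspOut _ (w (σ i)).2⟩ : AlgElt k A)) = 0 :=
        ext_trunc fun v => by
          rw [tensComp_trunc]
          exact smul_zero _
      rw [this, map_zero, map_zero]
    · rfl

/-- Needed because sums over supports omit zero components: the terms left out have to vanish. -/
theorem opFam_eq_zero (lam : k) {n m : ℕ} (sh : CAlg k A n) (w : Fin (m + 1) → Σ p, CRBO k A p)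
    (h : ∃ i, (w i).2 = 0) : opFam lam sh w = 0 :=
  opFam_eq_zero_of_summand lam _ w fun σ => by
    obtain ⟨i, hi⟩ := h
    obtain ⟨i, rfl⟩ := σ.surjective i
    have h1 : ∀ F : CAlg k A (m + 1), tensComp F
        (fun i => (⟨(w (σ i)).1, suspOut _ (w (σ i)).2⟩ : AlgElt k A)) = 0 := fun F =>
      tensComp_eq_zero F _ (t := i) (by dsimp only; rw [hi, map_zero])
    have h2 : braceOne (suspOut _ (w (σ 0)).2) (brace sh (fun i : Fin m =>
        (⟨(w (σ i.succ)).1, suspOut _ (w (σ i.succ)).2⟩ : AlgElt k A))) = 0 := by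
      refine Fin.cases (fun hi => ?_) (fun i hi => ?_) i hi
      · rw [hi, map_zero (suspOut _), braceOne_zero_left]
      · rw [brace_eq_zero sh _ (i := i) (by dsimp only; rw [hi, map_zero]), braceOne_zero_right]
    rw [opSummand, h2, map_zero (desuspTotal k A), smul_zero, smul_zero, ite_self, sub_zero]
    split_ifs with h
    · rw [h1, map_zero, map_zero]
    · rfl

/-! ### The mixed operations on copies of `τ` -/

/-- The part of `Φ^n` that comes from the operation with `r` arguments in `𝔠_RBO(A)`. -/
def phiPart (lam : k) (T : A →ₗ[k] A) (r n : ℕ) : Coch k A A n →ₗ[k] Coch k A A n :=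
  (if r = n then MultilinearMap.compLinearMapₗ (fun _ : Fin n => T) else 0) -
    (if 1 ≤ r ∧ r ≤ n then lam ^ (n - r) •
      ∑ S ∈ Finset.powersetCard (r - 1) (Finset.univ : Finset (Fin n)),
        T.compMultilinearMapₗ k ∘ₗ
          MultilinearMap.compLinearMapₗ (fun i : Fin n => if i ∈ S then T else LinearMap.id)
    else 0)

/-- The operation with `r` arguments accounts for the subsets of size `r - 1`. The term `r = 0`
matters only for `n = 0`, where it is the identity. -/
theorem sum_phiPart (lam : k) (T : A →ₗ[k] A) {n b : ℕ} (h : n < b) :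
    ∑ r ∈ Finset.range b, phiPart lam T r n = Phi lam T T n := by
  simp only [phiPart, Finset.sum_sub_distrib, Phi]
  rw [Finset.sum_ite_eq' (Finset.range b) n, if_pos (Finset.mem_range.2 h), ← Finset.sum_filter]
  congr 1
  symm
  refine Finset.sum_bij (fun j _ => j + 1) ?_ ?_ ?_ ?_
  · intro j hj
    simp only [Finset.mem_range, Finset.mem_filter] at hj ⊢
    omega
  · intro i _ j _ h
    exact Nat.succ_injective h
  · intro r hr
    simp only [Finset.mem_range, Finset.mem_filter] at hr ⊢
    exact ⟨r - 1, by omega, by omega⟩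
  · intro j _
    rw [Nat.sub_sub, Nat.add_sub_cancel]

/-- Since `sτ` has degree `0`, the sign inside the bracket is trivial. The first summand is `f ∘
T^{⊗ n}`; the second applies `T` outside and on `m` chosen arguments. -/
theorem opSummand_tau (lam : k) (T : A →ₗ[k] A) {n m : ℕ} (f : CAlg k A n) :
    opSummand lam f (fun _ : Fin (m + 1) => tauElt T) =
      DirectSum.lof k ℕ (CRBO k A) n (unhat n (phiPart lam T (m + 1) n (tilde n f))) := by
  refine ext_evalSeq_susp fun N u => ?_
  have h1 : evalSeq N (fun i => susp k A (u i)) (if h : m + 1 = n then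
      desuspTotal k A (DirectSum.lof k ℕ (CAlg k A) _
        (tensComp (f.domDomCongr (finCongr h.symm))
          (fun _ : Fin (m + 1) => linElt (suspConj T)))) else 0) =
      if n = N then (if m + 1 = n then tilde n f (trunc n fun i => T (u i)) else 0) else 0 := by
    by_cases h : m + 1 = n
    · subst h
      rw [dif_pos rfl, desuspTotal_eq, evalSeq_tensComp_lin _ _ (fun _ => suspConj T) fun _ => rfl,
        if_pos rfl]
      split_ifs <;> rfl
    · rw [dif_neg h, if_neg h, ite_self, map_zero]
  have h2 : evalSeq N (fun i => susp k A (u i)) (desuspTotal k A (braceOne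
      (suspOut (tauElt T).1 (tauElt T).2) (brace f fun _ : Fin m => linElt (suspConj T)))) =
      if n = N then ∑ S ∈ Finset.powersetCard m (Finset.univ : Finset (Fin n)),
        T (tilde n f (fun i => if i ∈ S then T (u i) else u i)) else 0 := by
    rw [desuspTotal_eq]
    change (susp k A).symm (evalSeq N _ (braceOne (MultilinearMap.ofSubsingleton k (Susp A)
      (Susp A) (0 : Fin 1) (suspConj T)) _)) = _
    rw [evalSeq_braceOne_lin, evalSeq_brace_lin]
    split_ifs
    · rw [map_sum, map_sum]
      refine Finset.sum_congr rfl fun S _ => ?_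
      change T (f _) = T (f _)
      congr 2
    · rw [map_zero, map_zero]
  have h3 : evalSeq N (fun i => susp k A (u i)) (if m + 1 ≤ n then
      ((1 - ((tauElt T).1 : ℤ)) * (1 - (n : ℤ))).negOnePow • lam ^ (n - (m + 1)) •
      desuspTotal k A (braceOne (suspOut (tauElt T).1 (tauElt T).2)
        (brace f fun _ : Fin m => linElt (suspConj T))) else 0) =
      if n = N then (if m + 1 ≤ n then lam ^ (n - (m + 1)) •
        ∑ S ∈ Finset.powersetCard m (Finset.univ : Finset (Fin n)),
        T (tilde n f (fun i => if i ∈ S then T (u i) else u i)) else 0) else 0 := by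
    by_cases h : m + 1 ≤ n
    · have hs : ((1 - ((tauElt T).1 : ℤ)) * (1 - (n : ℤ))).negOnePow = 1 := by
        simp [tauElt]
      rw [if_pos h, if_pos h, hs, one_smul, map_smul, h2, smul_ite, smul_zero]
    · rw [if_neg h, if_neg h, ite_self, map_zero]
  rw [opSummand, map_sub, evalSeq_lof]
  refine (congrArg₂ (· - ·) h1 h3).trans ?_
  by_cases hN : n = N
  · rw [if_pos hN, if_pos hN, if_pos hN]
    change _ = phiPart lam T (m + 1) n (tilde n f) (trunc n u)
    rw [phiPart, LinearMap.sub_apply, sub_apply]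
    congr 1
    · split_ifs <;> rfl
    · simp only [Nat.le_add_left, true_and, Nat.add_sub_cancel]
      split_ifs
      · rw [LinearMap.smul_apply, smul_apply, LinearMap.sum_apply, sum_apply]
        congr 1
        refine Finset.sum_congr rfl fun S _ => ?_
        change T (tilde n f _) = T (tilde n f _)
        congr 2
        funext i
        change _ = (if i ∈ S then T else LinearMap.id) (u i)
        split_ifs <;> rfl
      · rfl
  · rw [if_neg hN, if_neg hN, if_neg hN, sub_zero]

theorem sum_range_filter_le (m : ℕ) :
    ∑ i : Fin m, ∑ _j ∈ Finset.univ.filter (· ≤ i), -((1 : ℕ) : ℤ) =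
      -(((m + 1) * m / 2 : ℕ) : ℤ) := by
  have h : ∀ i : Fin m, ∑ _j ∈ Finset.univ.filter (· ≤ i), -((1 : ℕ) : ℤ) = -((i + 1 : ℕ) : ℤ) := by
    intro i
    have : (Finset.univ.filter (· ≤ i)).card = i + 1 := by
      rw [← Fin.card_Iic i]
      congr 1
      ext
      simp
    rw [Finset.sum_const, this]
    simp
  rw [Finset.sum_congr rfl fun i _ => h i, Finset.sum_neg_distrib, ← Nat.cast_sum,
    ← Finset.sum_range (fun i => i + 1)]
  have := Finset.sum_range_id (m + 1)
  rw [Finset.sum_range_succ'] at this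
  rw [add_zero] at this
  rw [this, Nat.add_sub_cancel]

/-- `l_{m+2}(f ⊗ τ^{⊗ (m+1)})`. -/
theorem opFam_tau (lam : k) (T : A →ₗ[k] A) {n m : ℕ} (f : CAlg k A n) :
    opFam lam f (fun _ : Fin (m + 1) => tauElt T) =
      (m + 1)! • (((m : ℤ) + 1) * (1 - (n : ℤ)) - (((m + 1) * m / 2 : ℕ) : ℤ)).negOnePow •
      DirectSum.lof k ℕ (CRBO k A) n (unhat n (phiPart lam T (m + 1) n (tilde n f))) := by
  rw [opFam_eq, opSummand_tau]
  -- All permutations give the same term: `χ = 1` in degree `-1`, and the other sign depends only on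
  -- degrees. Hence the factor `(m + 1)!`.
  have h1 : (tauElt T).1 = 1 := rfl
  simp only [h1, chi_neg_one, one_mul]
  rw [sum_range_filter_le, Finset.sum_const, Finset.card_univ, Fintype.card_perm,
    Fintype.card_fin, ← sub_eq_add_neg]

end Graded

/-- Only place `j` involves the product, so the value is linear in it. This splits `⋆` into its part
with `T` and its part with `lam`. -/
theorem apply_seqContract_add_smul {k : Type*} [Field k] {A M : Type*} [AddCommGroup A]
    [Module k A] [AddCommGroup M] [Module k M] (mul mul' : A →ₗ[k] A →ₗ[k] A) (c : k) {n : ℕ}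
    (f : Coch k A M n) {j : ℕ} (hj : j < n) (u : ℕ → A) :
    f (trunc n (seqContract (fun x y => (mul + c • mul') x y) j u)) =
      f (trunc n (seqContract (fun x y => mul x y) j u)) +
        c • f (trunc n (seqContract (fun x y => mul' x y) j u)) := by
  have h : ∀ op : A → A → A, trunc n (seqContract op j u) =
      Function.update (trunc n (seqContract (fun _ _ => 0) j u)) ⟨j,
        hj⟩ (op (u j) (u (j + 1))) := by
    intro op
    funext t
    simp only [trunc_apply, Function.update_apply, Fin.ext_iff, seqContract]
    split_ifs <;> first | rfl | omega
  rw [h, h fun x y => mul x y, h fun x y => mul' x y, ← f.map_update_smul, ← f.map_update_add]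
  rfl

section Graded

variable {k : Type*} [Field k] {A : Type*} [AddCommGroup A] [Module k A]

/-! ### The operations with the product as argument -/

theorem evalSeq_tensComp_two (mul : A →ₗ[k] A →ₗ[k] A) (w : Fin 2 → AlgElt k A) (N : ℕ)
    (u : ℕ → A) :
    evalSeq N (fun i => susp k A (u i))
      (DirectSum.lof k ℕ (CAlg k A) _ (tensComp (mcAlg mul) w)) =
      if (w 0).1 + (w 1).1 = N then susp k A (((1 - ((w 1).1 : ℤ)) * ((w 0).1 : ℤ)).negOnePow •
        mul (tilde _ (w 0).2 (trunc _ u)) (tilde _ (w 1).2 (trunc _ fun i => u ((w 0).1 + i))))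
      else 0 := by
  have h0 : Finset.univ.filter (· < (0 : Fin 2)) = ∅ := by decide
  have h1 : Finset.univ.filter (· < (1 : Fin 2)) = {0} := by decide
  rw [evalSeq_lof, tensComp_trunc]
  refine if_congr (by rw [Fin.sum_univ_two]) ?_ rfl
  simp only [Fin.sum_univ_two, h0, h1, Finset.sum_empty, Finset.sum_singleton, mul_zero, zero_add]
  rw [Units.smul_def, Units.smul_def, map_zsmul]
  congr 1
  change susp k A (mul _ _) = _
  simp only [h0, h1, Finset.sum_empty, Finset.sum_singleton, zero_add]
  rfl

/-- One insertion into a binary map: the composition term is absent and one factor `lam` remains,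
giving the part `lam a b` of `⋆` in `∂`. -/
theorem evalSeq_opSummand_one (lam : k) (mul : A →ₗ[k] A →ₗ[k] A) {p : ℕ} (g : CRBO k A p)
    (N : ℕ) (u : ℕ → A) :
    evalSeq N (fun i => susp k A (u i))
      (opSummand lam (mcAlg mul) (fun _ : Fin 1 => ⟨p, g⟩)) =
      if p + 1 = N then (-1 : k) ^ p • lam • ∑ j ∈ Finset.range p, (-1 : k) ^ j •
        hat p g (trunc p (seqContract (fun x y => mul x y) j u)) else 0 := by
  rw [opSummand, dif_neg (by norm_num), if_pos (by norm_num), zero_sub, map_neg,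
    evalSeq_units_smul, map_smul, desuspTotal_eq, brace_mcAlg_empty, braceOne_lof,
    evalSeq_brace_right_mcAlg]
  split_ifs
  · rw [LinearEquiv.symm_apply_apply,
      negOnePow_smul (k := k) (n := p + 1) ⟨-1, by push_cast; ring⟩, pow_succ, mul_neg_one,
      neg_smul, neg_neg, show lam ^ (2 - (0 + 1)) = lam from pow_one lam]
    rfl
  · simp

/-- With `τ` in front one gets the whole left action `▷` and the part `-T(x a)` of the right action.
-/
theorem evalSeq_opSummand_tau_left (lam : k) (mul : A →ₗ[k] A →ₗ[k] A) (T : A →ₗ[k] A) {p : ℕ}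
    (g : CRBO k A p) (w : Fin 2 → Σ p, CRBO k A p) (h0 : w 0 = tauElt T) (h1 : w 1 = ⟨p, g⟩)
    (N : ℕ) (u : ℕ → A) :
    evalSeq N (fun i => susp k A (u i)) (opSummand lam (mcAlg mul) w) =
      if p + 1 = N then
        (-1 : k) ^ (p + 1) • mul (T (u 0)) (hat p g (trunc p fun i => u (i + 1))) -
        T (mul (hat p g (trunc p u)) (u p) +
          (-1 : k) ^ (p + 1) • mul (u 0) (hat p g (trunc p fun i => u (i + 1)))) else 0 := by
  obtain rfl : w = ![tauElt T, ⟨p, g⟩] := by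
    funext i
    fin_cases i <;> assumption
  rw [opSummand, dif_pos rfl, if_pos le_rfl, map_sub, evalSeq_units_smul, map_smul,
    desuspTotal_eq, desuspTotal_eq]
  have ht := evalSeq_tensComp_two mul (fun i => (⟨((![tauElt T, ⟨p, g⟩] : Fin 2 → Σ p, CRBO k A p) i).1,
    suspOut _ ((![tauElt T, ⟨p, g⟩] : Fin 2 → Σ p, CRBO k A p) i).2⟩ : AlgElt k A)) N u
  have hb : evalSeq N (fun i => susp k A (u i)) (braceOne
      (suspOut (tauElt T).1 (tauElt T).2) (brace (mcAlg mul) fun _ : Fin 1 => ⟨p, suspOut p g⟩)) =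
      if p + 1 = N then susp k A (T (mul (hat p g (trunc p u)) (u p) +
          (-1 : k) ^ (p + 1) • mul (u 0) (hat p g (trunc p fun i => u (i + 1))))) else 0 := by
    refine (evalSeq_braceOne_lin (suspConj T) _ _ _).trans ?_
    rw [evalSeq_brace_mcAlg]
    split_ifs
    · rfl
    · rw [map_zero]
  have hb' : (fun i : Fin 1 => (⟨((![tauElt T, ⟨p, g⟩] : Fin 2 → Σ p, CRBO k A p) i.succ).1,
    suspOut _ ((![tauElt T, ⟨p, g⟩] : Fin 2 → Σ p, CRBO k A p) i.succ).2⟩ : AlgElt k A)) =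
      fun _ => ⟨p, suspOut p g⟩ := by
    funext i
    rw [Subsingleton.elim i 0]
    rfl
  rw [hb']
  refine (congrArg₂ (· - ·) (congrArg (susp k A).symm ht)
    (congrArg (fun x => _ • _ • (susp k A).symm x) hb)).trans ?_
  have hc : (tauElt T).1 + p = N ↔ p + 1 = N := by rw [add_comm]; rfl
  by_cases h : p + 1 = N
  · refine (congrArg₂ (fun x y => (susp k A).symm x - _ • _ • (susp k A).symm y)
      (if_pos (hc.2 h)) (if_pos h)).trans ?_
    rw [if_pos h, LinearEquiv.symm_apply_apply, LinearEquiv.symm_apply_apply, Nat.sub_self,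
      pow_zero, one_smul]
    have hs : ((1 - (((![tauElt T, ⟨p, g⟩] : Fin 2 → Σ p, CRBO k A p) 0).1 : ℤ)) *
      (1 - ((2 : ℕ) : ℤ))).negOnePow = 1 := by simp [tauElt]
    refine congrArg₂ (· - ·) ?_ ((congrArg (· • _) hs).trans (one_smul _ _))
    refine (negOnePow_smul (k := k) (n := p + 1) ⟨-p, ?_⟩ _).trans ?_
    · simp [tauElt]
      ring
    · congr 2
      change hat p g _ = _
      congr 1
      funext i
      exact congrArg u (add_comm _ _)
  · refine (congrArg₂ (fun x y => (susp k A).symm x - _ • _ • (susp k A).symm y)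
      (if_neg (mt hc.1 h)) (if_neg h)).trans ?_
    rw [if_neg h]
    simp

/-- With `τ` behind one gets the remaining part `x T(a)` of the right action and the part `a T(b) +
T(a) b` of `⋆`. -/
theorem evalSeq_opSummand_tau_right (lam : k) (mul : A →ₗ[k] A →ₗ[k] A) (T : A →ₗ[k] A) {p : ℕ}
    (g : CRBO k A p) (w : Fin 2 → Σ p, CRBO k A p) (h0 : w 0 = ⟨p, g⟩) (h1 : w 1 = tauElt T)
    (N : ℕ) (u : ℕ → A) :
    evalSeq N (fun i => susp k A (u i)) (opSummand lam (mcAlg mul) w) =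
      if p + 1 = N then
        mul (hat p g (trunc p u)) (T (u p)) + (-1 : k) ^ p • ∑ j ∈ Finset.range p, (-1 : k) ^ j •
        hat p g (trunc p (seqContract (fun x y => (mul.compl₂ T + mul ∘ₗ T) x y) j u)) else 0 := by
  obtain rfl : w = ![⟨p, g⟩, tauElt T] := by
    funext i
    fin_cases i <;> assumption
  rw [opSummand, dif_pos rfl, if_pos le_rfl, map_sub, evalSeq_units_smul, map_smul,
    desuspTotal_eq, desuspTotal_eq]
  have ht := evalSeq_tensComp_two mul (fun i => (⟨((![⟨p, g⟩, tauElt T] : Fin 2 → Σ p, CRBO k A p) i).1,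
    suspOut _ ((![⟨p, g⟩, tauElt T] : Fin 2 → Σ p, CRBO k A p) i).2⟩ : AlgElt k A)) N u
  have hb : evalSeq N (fun i => susp k A (u i)) (braceOne
      (suspOut p g) (brace (mcAlg mul) fun _ : Fin 1 => linElt (suspConj T))) =
      if p + 1 = N then susp k A (∑ j ∈ Finset.range p, (-1 : k) ^ j •
        hat p g (trunc p (seqContract (fun x y => (mul.compl₂ T + mul ∘ₗ T) x y) j u))) else 0 := by
    rw [brace_mcAlg_linElt, braceOne_lof, evalSeq_brace_right_mcAlg]
    rfl
  have hb' : (fun i : Fin 1 => (⟨((![⟨p, g⟩, tauElt T] : Fin 2 → Σ p, CRBO k A p) i.succ).1,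
    suspOut _ ((![⟨p, g⟩, tauElt T] : Fin 2 → Σ p, CRBO k A p) i.succ).2⟩ : AlgElt k A)) =
      fun _ => linElt (suspConj T) := by
    funext i
    rw [Subsingleton.elim i 0]
    rfl
  rw [hb']
  refine (congrArg₂ (· - ·) (congrArg (susp k A).symm ht)
    (congrArg (fun x => _ • _ • (susp k A).symm x) hb)).trans ?_
  by_cases h : p + 1 = N
  · refine (congrArg₂ (fun x y => (susp k A).symm x - _ • _ • (susp k A).symm y)
      (if_pos h) (if_pos h)).trans ?_
    rw [if_pos h, LinearEquiv.symm_apply_apply, LinearEquiv.symm_apply_apply, Nat.sub_self,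
      pow_zero, one_smul, sub_eq_add_neg]
    refine congrArg₂ (· + ·) ?_ ?_
    · refine (congrArg (· • _) (?_ : Int.negOnePow _ = 1)).trans (one_smul _ _)
      simp [tauElt]
    · refine (congrArg (- ·) (negOnePow_smul (k := k) (n := p + 1) ⟨-1, ?_⟩ _)).trans ?_
      · simp
        ring
      · rw [pow_succ, mul_neg_one, neg_smul, neg_neg]
  · refine (congrArg₂ (fun x y => (susp k A).symm x - _ • _ • (susp k A).symm y)
      (if_neg h) (if_neg h)).trans ?_
    rw [if_neg h]
    simp

/-- The three summands, one for `m, g` and one for each order of `τ` and `g`, all carry the sign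
`-1` and together contain each term of `∂ g` once. -/
theorem opFam_mcAlg (lam : k) (mul : A →ₗ[k] A →ₗ[k] A) (T : A →ₗ[k] A) {p : ℕ}
    (g : CRBO k A p) :
    opFam lam (mcAlg mul) (Function.update (fun _ : Fin 1 => tauElt T) (Fin.last 0) ⟨p, g⟩) +
      opFam lam (mcAlg mul) (Function.update (fun _ : Fin 2 => tauElt T) (Fin.last 1) ⟨p, g⟩) =
    -DirectSum.lof k ℕ (CRBO k A) (p + 1)
      (unhat (p + 1) (rboDiff lam mul T T mul mul p (hat p g))) := by
  refine ext_evalSeq_susp fun N u => ?_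
  have hw : (Function.update (fun _ : Fin 1 => tauElt T) (Fin.last 0) ⟨p, g⟩) =
      fun _ => ⟨p, g⟩ := by
    funext i
    rw [Subsingleton.elim i (Fin.last 0), Function.update_self]
  have h1 : evalSeq N (fun i => susp k A (u i))
      (opFam lam (mcAlg mul) fun _ : Fin 1 => (⟨p, g⟩ : Σ p, CRBO k A p)) =
      -evalSeq N (fun i => susp k A (u i))
        (opSummand lam (mcAlg mul) (fun _ : Fin 1 => ⟨p, g⟩)) := by
    rw [opFam_eq, show (Finset.univ : Finset (Equiv.Perm (Fin (0 + 1)))) = {1} by decide,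
      Finset.sum_singleton, evalSeq_units_smul]
    simp [chi]
  let w : Fin 2 → Σ p, CRBO k A p := Function.update (fun _ => tauElt T) (Fin.last 1) ⟨p, g⟩
  have hu : (Finset.univ : Finset (Equiv.Perm (Fin 2))) = {1, Equiv.swap 0 1} := by decide
  have h2 : evalSeq N (fun i => susp k A (u i)) (opFam lam (mcAlg mul) w) =
      -evalSeq N (fun i => susp k A (u i)) (opSummand lam (mcAlg mul) w) -
      evalSeq N (fun i => susp k A (u i))
        (opSummand lam (mcAlg mul) fun i => w (Equiv.swap 0 1 i)) := by
    have hc1 : chi (1 : Equiv.Perm (Fin 2)) (fun i => -((w i).1 : ℤ)) = 1 := by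
      simp [chi, Fin.sum_univ_two]
    -- Transposing `τ` of degree `-1` and `g` of degree `-p` gives `-(-1)^p`; the factor `(-1)^p`
    -- cancels against the outer sign of the same summand.
    have hc2 : chi (Equiv.swap 0 1 : Equiv.Perm (Fin 2)) (fun i => -((w i).1 : ℤ)) =
        -(p : ℤ).negOnePow := by
      simp [chi, Fin.sum_univ_two, w, tauElt]
    have hs1 : (((1 : ℕ) : ℤ) + 1) * (1 - ((2 : ℕ) : ℤ)) + ∑ i : Fin 1,
        ∑ j ∈ Finset.univ.filter (· ≤ i), -((w ((1 : Equiv.Perm (Fin 2)) j.castSucc)).1 : ℤ) =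
        -3 := by
      simp [w, tauElt]
    have hs2 : (((1 : ℕ) : ℤ) + 1) * (1 - ((2 : ℕ) : ℤ)) + ∑ i : Fin 1,
        ∑ j ∈ Finset.univ.filter (· ≤ i),
          -((w ((Equiv.swap 0 1 : Equiv.Perm (Fin 2)) j.castSucc)).1 : ℤ) = -2 - (p : ℤ) := by
      simp [w, sub_eq_add_neg]
    rw [opFam_eq, hu, Finset.sum_pair (by decide), map_add, evalSeq_units_smul,
      evalSeq_units_smul, hc1, hc2, hs1, hs2]
    have e1 : (-3 : ℤ).negOnePow = -1 := Int.negOnePow_odd _ (by decide)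
    have e2 : (-2 - (p : ℤ)).negOnePow = (p : ℤ).negOnePow :=
      (Int.negOnePow_eq_iff _ _).2 ⟨-1 - p, by ring⟩
    rw [e1, e2, one_mul, neg_mul, Int.units_mul_self, Units.neg_smul, one_smul, Units.neg_smul,
      one_smul, sub_eq_add_neg]
    rfl
  rw [hw, map_add, map_neg, h1, h2, evalSeq_opSummand_one,
    evalSeq_opSummand_tau_left lam mul T g w rfl rfl,
    evalSeq_opSummand_tau_right lam mul T g (fun i => w (Equiv.swap 0 1 i)) rfl rfl, evalSeq_lof]
  split_ifs
  · change _ = -(rboDiff lam mul T T mul mul p (hat p g) (trunc (p + 1) u))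
    have hmid : ∑ j ∈ Finset.range p, (-1 : k) ^ (p - j) •
        hat p g (trunc p (seqContract (fun x y => starMul lam mul T x y) j u)) =
        (-1 : k) ^ p • ∑ j ∈ Finset.range p, (-1 : k) ^ j •
          hat p g (trunc p (seqContract (fun x y => (mul.compl₂ T + mul ∘ₗ T) x y) j u)) +
        (-1 : k) ^ p • lam • ∑ j ∈ Finset.range p, (-1 : k) ^ j •
          hat p g (trunc p (seqContract (fun x y => mul x y) j u)) := by
      rw [smul_comm _ lam, Finset.smul_sum, Finset.smul_sum, Finset.smul_sum,
        ← Finset.sum_add_distrib]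
      refine Finset.sum_congr rfl fun j hj => ?_
      rw [Finset.mem_range] at hj
      rw [starMul, apply_seqContract_add_smul _ _ lam _ hj]
      obtain ⟨c, rfl⟩ : ∃ c, p = j + c := ⟨p - j, by omega⟩
      have hc : (-1 : k) ^ (j + c) * (-1) ^ j = (-1) ^ (j + c - j) := by
        rw [Nat.add_sub_cancel_left]
        have : (-1 : k) ^ j * (-1) ^ j = 1 := by rw [← mul_pow]; simp
        linear_combination ((-1 : k) ^ c) * this
      rw [smul_smul, smul_smul, hc, smul_add, smul_smul, smul_smul, mul_assoc, hc, mul_comm lam]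
    rw [rboDiff, hochDiff_trunc, hmid]
    simp only [leftAct_apply, rightAct_apply, map_add, map_smul, smul_sub]
    abel
  · simp

/-! ### The comparison map -/

theorem comparison_inl (n : ℕ) (f : CAlg k A n) :
    comparison k A (DirectSum.lof k ℕ (CAlg k A) n f, 0) =
      DirectSum.lof k ℕ (CochRBA k A A) n (inclAlg k A A n (tilde n f)) := by
  rw [comparison, LinearMap.coprod_apply, map_zero, add_zero, DirectSum.toModule_lof]
  rfl

theorem comparison_inr (n : ℕ) (g : CRBO k A n) :
    comparison k A (0, DirectSum.lof k ℕ (CRBO k A) n g) =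
      DirectSum.lof k ℕ (CochRBA k A A) (n + 1) (inclRBO k A A n (hat n g)) := by
  rw [comparison, LinearMap.coprod_apply, map_zero, zero_add, DirectSum.toModule_lof]
  rfl

variable (k A) in
/-- The inverse of the comparison map on `C^n_RBA(A)`. -/
def uncompareComp : ∀ n, CochRBA k A A n →ₗ[k] CRBA k A
  | 0 => (LinearMap.inl k _ _ ∘ₗ DirectSum.lof k ℕ (CAlg k A) 0 ∘ₗ untilde 0 :
      Coch k A A 0 →ₗ[k] CRBA k A)
  | n + 1 => (LinearMap.coprod
      (LinearMap.inl k _ _ ∘ₗ DirectSum.lof k ℕ (CAlg k A) (n + 1) ∘ₗ untilde (n + 1))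
      (LinearMap.inr k _ _ ∘ₗ DirectSum.lof k ℕ (CRBO k A) n ∘ₗ unhat n) :
      Coch k A A (n + 1) × Coch k A A n →ₗ[k] CRBA k A)

theorem uncompareComp_inclAlg (n : ℕ) (f : Coch k A A n) :
    uncompareComp k A n (inclAlg k A A n f) =
      (DirectSum.lof k ℕ (CAlg k A) n (untilde n f), 0) := by
  cases n with
  | zero => rfl
  | succ n =>
    change LinearMap.coprod _ _ (f, (0 : Coch k A A n)) = _
    rw [LinearMap.coprod_apply, map_zero, add_zero]
    rfl

theorem uncompareComp_inclRBO (n : ℕ) (g : Coch k A A n) :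
    uncompareComp k A (n + 1) (inclRBO k A A n g) =
      (0, DirectSum.lof k ℕ (CRBO k A) n (unhat n g)) := by
  change LinearMap.coprod _ _ ((0 : Coch k A A (n + 1)), g) = _
  rw [LinearMap.coprod_apply, map_zero, zero_add]
  rfl

theorem comparison_uncompareComp (n : ℕ) (c : CochRBA k A A n) :
    comparison k A (uncompareComp k A n c) = DirectSum.lof k ℕ (CochRBA k A A) n c := by
  cases n with
  | zero => exact comparison_inl 0 (untilde 0 c)
  | succ n =>
    obtain ⟨f, g⟩ : Coch k A A (n + 1) × Coch k A A n := c
    have h : ((f, g) : CochRBA k A A (n + 1)) = inclAlg k A A (n + 1) f + inclRBO k A A n g :=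
      Prod.ext (add_zero f).symm (zero_add g).symm
    rw [h, map_add, uncompareComp_inclAlg, uncompareComp_inclRBO, map_add, map_add,
      comparison_inl, comparison_inr]
    rfl

variable (k A) in
/-- The inverse of the comparison map. -/
def uncompare : (⨁ n, CochRBA k A A n) →ₗ[k] CRBA k A :=
  DirectSum.toModule k ℕ _ (uncompareComp k A)

theorem comparison_uncompare (c : ⨁ n, CochRBA k A A n) :
    comparison k A (uncompare k A c) = c := by
  have : comparison k A ∘ₗ uncompare k A = LinearMap.id :=
    DirectSum.linearMap_ext k fun n => LinearMap.ext fun c => by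
      rw [LinearMap.comp_apply, LinearMap.comp_apply, uncompare, DirectSum.toModule_lof,
        comparison_uncompareComp]
      rfl
  exact LinearMap.congr_fun this c

theorem uncompare_comparison (x : CRBA k A) : uncompare k A (comparison k A x) = x := by
  have : uncompare k A ∘ₗ comparison k A = LinearMap.id := by
    refine LinearMap.prod_ext ?_ ?_ <;>
      refine DirectSum.linearMap_ext k fun n => LinearMap.ext fun f => ?_
    · change uncompare k A (comparison k A (DirectSum.lof k ℕ (CAlg k A) n f, 0)) = _
      rw [comparison_inl, uncompare, DirectSum.toModule_lof, uncompareComp_inclAlg]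
      rfl
    · change uncompare k A (comparison k A (0, DirectSum.lof k ℕ (CRBO k A) n f)) = _
      rw [comparison_inr, uncompare, DirectSum.toModule_lof, uncompareComp_inclRBO]
      rfl
  exact LinearMap.congr_fun this x

theorem comparison_bijective : Function.Bijective (comparison k A) :=
  ⟨Function.LeftInverse.injective uncompare_comparison,
    Function.RightInverse.surjective comparison_uncompare⟩

theorem eq_lof_of_forall_ne {β : ℕ → Type*} [∀ n, AddCommGroup (β n)] [∀ n, Module k (β n)]
    (X : ⨁ n, β n) (n : ℕ) (h : ∀ i, i ≠ n → X i = 0) : X = DirectSum.lof k ℕ β n (X n) := by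
  refine DFinsupp.ext fun i => ?_
  by_cases hi : i = n
  · subst hi
    exact (DirectSum.lof_apply k i (X i)).symm
  · rw [DirectSum.lof_eq_of, DirectSum.of_eq_of_ne _ _ _ hi]
    exact h i hi

/-- Degree `1 - n` consists of the maps with `n` arguments into `sA` and those with `n - 1`
arguments into `A`; for `n = 0` the second kind does not exist. -/
theorem mem_homogeneous_iff (n : ℕ) (x : CRBA k A) : x ∈ homogeneous k A (1 - (n : ℤ)) ↔
    comparison k A x ∈ LinearMap.range (DirectSum.lof k ℕ (CochRBA k A A) n) := by
  constructor
  · rintro ⟨h1, h2⟩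
    obtain ⟨X, Y⟩ := x
    have hX := eq_lof_of_forall_ne (k := k) X n fun i hi => h1 i (by omega)
    rw [← Prod.fst_add_snd (X, Y), map_add]
    refine Submodule.add_mem _ ?_ ?_
    · dsimp only
      rw [hX, comparison_inl]
      exact ⟨_, rfl⟩
    · cases n with
      | zero =>
        have hY : Y = 0 := DFinsupp.ext fun i => h2 i (by push_cast; omega)
        dsimp only
        rw [hY, Prod.mk_zero_zero, map_zero]
        exact Submodule.zero_mem _
      | succ n =>
        have hY := eq_lof_of_forall_ne (k := k) Y n fun i hi => h2 i (by push_cast; omega)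
        dsimp only
        rw [hY, comparison_inr]
        exact ⟨_, rfl⟩
  · rintro ⟨c, hc⟩
    have hx : x = uncompareComp k A n c := by
      rw [← uncompare_comparison x, ← hc, uncompare, DirectSum.toModule_lof]
    rw [hx]
    have hA : ∀ n (f : Coch k A A n), ((DirectSum.lof k ℕ (CAlg k A) n (untilde n f), 0) :
        CRBA k A) ∈ homogeneous k A (1 - (n : ℤ)) := fun n f =>
      ⟨fun i hi => by
        rw [DirectSum.lof_eq_of, DirectSum.of_eq_of_ne _ _ _ (by rintro rfl; exact hi rfl)],
        fun i _ => rfl⟩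
    cases n with
    | zero => exact hA 0 c
    | succ n =>
      obtain ⟨f, g⟩ : Coch k A A (n + 1) × Coch k A A n := c
      have h : ((f, g) : CochRBA k A A (n + 1)) = inclAlg k A A (n + 1) f + inclRBO k A A n g :=
        Prod.ext (add_zero f).symm (zero_add g).symm
      rw [h, map_add, uncompareComp_inclAlg, uncompareComp_inclRBO]
      refine Submodule.add_mem _ (hA _ _) ⟨fun i _ => rfl, fun i hi => ?_⟩
      rw [DirectSum.lof_eq_of, DirectSum.of_eq_of_ne _ _ _ (by rintro rfl; apply hi; push_cast; ring)]

/-! ### The operations on copies of `α` and one other element -/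

-- When all arguments but one are homogeneous, the sum over tuples of components reduces to the
-- components of the remaining one. If a homogeneous argument is zero its support is empty, and then
-- `hH` makes the right side vanish as well.
open Classical in
theorem sum_piFinset_support {D : Type*} [AddCommGroup D] {m : ℕ}
    (Y : Fin (m + 1) → ⨁ n, CRBO k A n) (i₀ : Fin (m + 1)) (w : Fin (m + 1) → Σ p, CRBO k A p)
    (hY : ∀ i, i ≠ i₀ → Y i = DirectSum.lof k ℕ (CRBO k A) (w i).1 (w i).2)
    (H : (Fin (m + 1) → Σ p, CRBO k A p) → D) (hH : ∀ w, (∃ i, (w i).2 = 0) → H w = 0) :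
    ∑ p ∈ Fintype.piFinset (fun i => DFinsupp.support (Y i)), H (fun i => ⟨p i, Y i (p i)⟩) =
      ∑ c ∈ DFinsupp.support (Y i₀), H (Function.update w i₀ ⟨c, Y i₀ c⟩) := by
  have hval : ∀ i, i ≠ i₀ → Y i (w i).1 = (w i).2 := fun i hi => by
    rw [hY i hi, DirectSum.lof_apply]
  have hne : ∀ i, i ≠ i₀ → ∀ n ∈ DFinsupp.support (Y i), n = (w i).1 := fun i hi n hn => by
    by_contra h
    rw [DFinsupp.mem_support_iff, hY i hi, DirectSum.lof_eq_of,
      DirectSum.of_eq_of_ne _ _ _ h] at hn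
    exact hn rfl
  by_cases h0 : ∃ i, i ≠ i₀ ∧ (w i).2 = 0
  · obtain ⟨i, hi, hw⟩ := h0
    rw [Finset.sum_eq_zero, Finset.sum_eq_zero]
    · intro c _
      exact hH _ ⟨i, by rw [Function.update_of_ne hi, hw]⟩
    · intro p hp
      have h := Fintype.mem_piFinset.1 hp i
      have h' := DFinsupp.mem_support_iff.1 h
      rw [hne i hi _ h, hval i hi] at h'
      exact absurd hw h'
  · push Not at h0
    symm
    have he : ∀ c, (fun i => (⟨Function.update (fun i => (w i).1) i₀ c i,
        Y i (Function.update (fun i => (w i).1) i₀ c i)⟩ : Σ p, CRBO k A p)) =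
        Function.update w i₀ ⟨c, Y i₀ c⟩ := by
      intro c
      funext i
      by_cases hi : i = i₀
      · subst hi
        rw [Function.update_self, Function.update_self]
      · rw [Function.update_of_ne hi, Function.update_of_ne hi, hval i hi]
    refine Finset.sum_bij (fun c _ => Function.update (fun i => (w i).1) i₀ c) ?_ ?_ ?_ ?_
    · intro c hc
      refine Fintype.mem_piFinset.2 fun i => ?_
      by_cases hi : i = i₀
      · subst hi
        rwa [Function.update_self]
      · rw [Function.update_of_ne hi, DFinsupp.mem_support_iff, hval i hi]
        exact h0 i hi
    · intro c _ c' _ h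
      simpa using congrFun h i₀
    · intro p hp
      rw [Fintype.mem_piFinset] at hp
      refine ⟨p i₀, hp i₀, ?_⟩
      funext i
      by_cases hi : i = i₀
      · subst hi
        rw [Function.update_self]
      · rw [Function.update_of_ne hi]
        exact (hne i hi _ (hp i)).symm
    · intro c _
      rw [he]

open Classical in
/-- The part of the operation with `m + 2` arguments where the element of `𝔠_Alg(A)` is taken from
the argument with index `j`. -/
def opInner (lam : k) {m : ℕ} (y : Fin (m + 2) → CRBA k A) (j : Fin (m + 2)) : ⨁ u, CRBO k A u :=
  ∑ n ∈ DFinsupp.support (y j).1,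
    ∑ p ∈ Fintype.piFinset (fun i : Fin (m + 1) => DFinsupp.support (y (j.succAbove i)).2),
      ((1 - (n : ℤ)) *
          (∑ i ∈ Finset.univ.filter (fun i : Fin (m + 1) => (i : ℕ) < j), -(p i : ℤ)) +
        (j : ℤ)).negOnePow •
        opFam lam ((y j).1 n) (fun i => ⟨p i, (y (j.succAbove i)).2 (p i)⟩)

theorem op_eq (lam : k) {m : ℕ} (y : Fin (m + 2) → CRBA k A) :
    op lam (m + 2) y = (if m = 0 then gerst (y 0).1 (y 1).1 else 0, ∑ j, opInner lam y j) := rfl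

theorem card_filter_val_lt {m : ℕ} (j : Fin (m + 2)) :
    (Finset.univ.filter (fun i : Fin (m + 1) => (i : ℕ) < j)).card = j := by
  rw [Fin.card_filter_val_lt]
  omega

-- Moving an element with `n` arguments past `j` copies of `τ` costs `(1 - n)(-j) + j = n j`.
open Classical in
theorem opInner_of_tau (lam : k) (T : A →ₗ[k] A) {m : ℕ} (y : Fin (m + 2) → CRBA k A)
    (j : Fin (m + 2)) (h : ∀ i, (y (j.succAbove i)).2 =
      DirectSum.lof k ℕ (CRBO k A) (tauElt T).1 (tauElt T).2) :
    opInner lam y j = ∑ n ∈ DFinsupp.support (y j).1,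
      ((n : ℤ) * j).negOnePow • opFam lam ((y j).1 n) (fun _ : Fin (m + 1) => tauElt T) := by
  refine Finset.sum_congr rfl fun n _ => ?_
  let H : (Fin (m + 1) → Σ p, CRBO k A p) → ⨁ u, CRBO k A u := fun w =>
    ((1 - (n : ℤ)) *
          (∑ i ∈ Finset.univ.filter (fun i : Fin (m + 1) => (i : ℕ) < j), -((w i).1 : ℤ)) +
        (j : ℤ)).negOnePow • opFam lam ((y j).1 n) w
  have hH : ∀ w, (∃ i, (w i).2 = 0) → H w = 0 := fun w hw => by
    simp only [H]
    rw [opFam_eq_zero lam _ w hw, smul_zero]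
  refine (sum_piFinset_support (fun i => (y (j.succAbove i)).2) 0 (fun _ => tauElt T)
    (fun i _ => h i) H hH).trans ?_
  rw [h 0, sum_support_lof (fun c b => H (Function.update (fun _ => tauElt T) 0 ⟨c, b⟩)) _ _
    fun h0 => hH _ ⟨0, by rw [Function.update_self]; exact h0⟩]
  have : Function.update (fun _ : Fin (m + 1) => tauElt T) 0 ⟨(tauElt T).1, (tauElt T).2⟩ =
      fun _ => tauElt T := Function.update_eq_self 0 _
  rw [this]
  have h1 : (tauElt T).1 = 1 := rfl
  simp only [H, h1]
  rw [Finset.sum_const, card_filter_val_lt]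
  congr 1
  rw [Int.negOnePow_eq_iff]
  exact ⟨0, by simp; ring⟩

-- Here `m` comes from one of the copies of `α` and `g` from the last argument. Moving `m` past `j`
-- copies of `τ` costs the even exponent `2 j`, so every position contributes equally.
open Classical in
theorem opInner_of_mcAlg (lam : k) (mul : A →ₗ[k] A →ₗ[k] A) (T : A →ₗ[k] A) {m : ℕ}
    (y : Fin (m + 2) → CRBA k A) (j : Fin (m + 1))
    (hj : (y j.castSucc).1 = DirectSum.lof k ℕ (CAlg k A) 2 (mcAlg mul))
    (h : ∀ i, i ≠ Fin.last m → (y (j.castSucc.succAbove i)).2 =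
      DirectSum.lof k ℕ (CRBO k A) (tauElt T).1 (tauElt T).2) :
    opInner lam y j.castSucc = ∑ c ∈ DFinsupp.support (y (Fin.last (m + 1))).2,
      opFam lam (mcAlg mul) (Function.update (fun _ : Fin (m + 1) => tauElt T) (Fin.last m)
        ⟨c, (y (Fin.last (m + 1))).2 c⟩) := by
  let H : ∀ n, CAlg k A n → (Fin (m + 1) → Σ p, CRBO k A p) → ⨁ u, CRBO k A u := fun n f w =>
    ((1 - (n : ℤ)) * (∑ i ∈ Finset.univ.filter
        (fun i : Fin (m + 1) => (i : ℕ) < j.castSucc), -((w i).1 : ℤ)) +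
        ((j.castSucc : ℕ) : ℤ)).negOnePow • opFam lam f w
  have hH : ∀ n f w, (∃ i, (w i).2 = 0) → H n f w = 0 := fun n f w hw => by
    simp only [H]
    rw [opFam_eq_zero lam _ w hw, smul_zero]
  have hlast : j.castSucc.succAbove (Fin.last m) = Fin.last (m + 1) :=
    Fin.succAbove_ne_last_last (Fin.castSucc_lt_last j).ne
  have key : ∀ n f, ∑ p ∈ Fintype.piFinset (fun i : Fin (m + 1) =>
      DFinsupp.support (y (j.castSucc.succAbove i)).2),
      H n f (fun i => ⟨p i, (y (j.castSucc.succAbove i)).2 (p i)⟩) = _ := fun n f =>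
    sum_piFinset_support (fun i => (y (j.castSucc.succAbove i)).2) (Fin.last m)
      (fun _ => tauElt T) h (H n f) (hH n f)
  have h0 : opInner lam y j.castSucc = ∑ n ∈ DFinsupp.support (y j.castSucc).1,
      ∑ c ∈ DFinsupp.support (y (j.castSucc.succAbove (Fin.last m))).2,
        H n ((y j.castSucc).1 n) (Function.update (fun _ => tauElt T) (Fin.last m)
          ⟨c, (y (j.castSucc.succAbove (Fin.last m))).2 c⟩) :=
    Finset.sum_congr rfl fun n _ => key n _
  rw [h0, hj, sum_support_lof (fun n f => ∑ c ∈ DFinsupp.support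
    (y (j.castSucc.succAbove (Fin.last m))).2, H n f (Function.update (fun _ => tauElt T)
      (Fin.last m) ⟨c, (y (j.castSucc.succAbove (Fin.last m))).2 c⟩)), hlast]
  · refine Finset.sum_congr rfl fun c _ => ?_
    have hs : ∀ i ∈ Finset.univ.filter (fun i : Fin (m + 1) => (i : ℕ) < j.castSucc),
        -((Function.update (fun _ : Fin (m + 1) => tauElt T) (Fin.last m)
        ⟨c, (y (Fin.last (m + 1))).2 c⟩ i).1 : ℤ) = -1 := fun i hi => by
      have hi' : (i : ℕ) < j := (Finset.mem_filter.1 hi).2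
      rw [Function.update_of_ne]
      · rfl
      · rintro rfl
        rw [Fin.val_last] at hi'
        omega
    simp only [H]
    rw [Finset.sum_congr rfl hs, Finset.sum_const, card_filter_val_lt,
      Int.negOnePow_even _ ⟨(j : ℕ), ?_⟩, one_smul]
    simp
  · intro hm
    refine Finset.sum_eq_zero fun c _ => ?_
    simp only [H]
    rw [hm, opFam_zero, smul_zero]

-- More than `b` insertions into a map with at most `b` arguments give zero, and `2 < N` excludes
-- the Gerstenhaber bracket. This is what makes all the sums finite.
open Classical in
theorem op_eq_zero (lam : k) {N : ℕ} (y : Fin N → CRBA k A) (b : ℕ)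
    (hb : ∀ j, ∀ n ∈ DFinsupp.support (y j).1, n ≤ b) (hN : b + 1 < N) (hN' : 2 < N) :
    op lam N y = 0 := by
  obtain ⟨m, rfl⟩ : ∃ m, N = m + 2 := ⟨N - 2, by omega⟩
  rw [op_eq, if_neg (by omega), Finset.sum_eq_zero, Prod.mk_zero_zero]
  intro j _
  refine Finset.sum_eq_zero fun n hn => Finset.sum_eq_zero fun p _ => ?_
  rw [opFam_eq_zero_of_lt lam (by have := hb j n hn; omega), smul_zero]

/-! ### The differential on `𝔠_RBA(A)` -/

open Classical in
theorem toModule_eq_sum {β : ℕ → Type*} [∀ n, AddCommGroup (β n)] [∀ n, Module k (β n)]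
    {D : Type*} [AddCommGroup D] [Module k D] (F : ∀ n, β n →ₗ[k] D) (X : ⨁ n, β n) :
    DirectSum.toModule k ℕ D F X = ∑ n ∈ DFinsupp.support X, F n (X n) := by
  conv_lhs => rw [← DirectSum.sum_support_of X, map_sum]
  refine Finset.sum_congr rfl fun n _ => ?_
  rw [← DirectSum.lof_eq_of k, DirectSum.toModule_lof]

/-- The Hochschild differential on `𝔠_Alg(A)`. -/
def algDiff (mul : A →ₗ[k] A →ₗ[k] A) : (⨁ n, CAlg k A n) →ₗ[k] ⨁ n, CAlg k A n :=
  DirectSum.toModule k ℕ _ fun n => DirectSum.lof k ℕ (CAlg k A) (n + 1) ∘ₗ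
    untilde (n + 1) ∘ₗ hochDiff mul mul mul n ∘ₗ tilde n

/-- The differential `∂` on `𝔠_RBO(A)`. -/
def opDiff (lam : k) (mul : A →ₗ[k] A →ₗ[k] A) (T : A →ₗ[k] A) :
    (⨁ n, CRBO k A n) →ₗ[k] ⨁ n, CRBO k A n :=
  DirectSum.toModule k ℕ _ fun n => DirectSum.lof k ℕ (CRBO k A) (n + 1) ∘ₗ
    unhat (n + 1) ∘ₗ rboDiff lam mul T T mul mul n ∘ₗ hat n

/-- The map `Φ : 𝔠_Alg(A) → 𝔠_RBO(A)`. -/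
def totalPhi (lam : k) (T : A →ₗ[k] A) : (⨁ n, CAlg k A n) →ₗ[k] ⨁ n, CRBO k A n :=
  DirectSum.toModule k ℕ _ fun n => DirectSum.lof k ℕ (CRBO k A) n ∘ₗ
    unhat n ∘ₗ Phi lam T T n ∘ₗ tilde n

/-- The part of `Φ` that comes from the operation with `r` arguments in `𝔠_RBO(A)`. -/
def totalPhiPart (lam : k) (T : A →ₗ[k] A) (r : ℕ) : (⨁ n, CAlg k A n) →ₗ[k] ⨁ n, CRBO k A n :=
  DirectSum.toModule k ℕ _ fun n => DirectSum.lof k ℕ (CRBO k A) n ∘ₗ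
    unhat n ∘ₗ phiPart lam T r n ∘ₗ tilde n

open Classical in
theorem sum_totalPhiPart (lam : k) (T : A →ₗ[k] A) (X : ⨁ n, CAlg k A n) {b : ℕ}
    (hb : ∀ n ∈ DFinsupp.support X, n < b) :
    ∑ r ∈ Finset.range b, totalPhiPart lam T r X = totalPhi lam T X := by
  simp only [totalPhiPart, totalPhi, toModule_eq_sum]
  rw [Finset.sum_comm]
  refine Finset.sum_congr rfl fun n hn => ?_
  simp only [LinearMap.comp_apply]
  rw [← map_sum, ← map_sum, ← LinearMap.sum_apply, sum_phiPart lam T (hb n hn)]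

/-- The operation `l_1` is the missing piece `r = 0` of `Φ`, which lives in arity `0`, where `T^{⊗
0}` is the identity. -/
theorem totalPhiPart_zero (lam : k) (T : A →ₗ[k] A) (X : ⨁ n, CAlg k A n) :
    totalPhiPart lam T 0 X = DirectSum.lof k ℕ (CRBO k A) 0 (desuspOut 0 (X 0)) := by
  have : totalPhiPart lam T 0 = DirectSum.lof k ℕ (CRBO k A) 0 ∘ₗ desuspOut 0 ∘ₗ
      DirectSum.component k ℕ (CAlg k A) 0 := by
    refine DirectSum.linearMap_ext k fun n => LinearMap.ext fun f => ?_
    rw [LinearMap.comp_apply, totalPhiPart, DirectSum.toModule_lof]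
    change DirectSum.lof k ℕ (CRBO k A) n (unhat n (phiPart lam T 0 n (tilde n f))) =
      DirectSum.lof k ℕ (CRBO k A) 0 (desuspOut 0 (DirectSum.lof k ℕ (CAlg k A) n f 0))
    cases n with
    | zero =>
      rw [DirectSum.lof_apply]
      congr 1
      refine ext_trunc fun v => ?_
      have : phiPart lam T 0 0 = MultilinearMap.compLinearMapₗ (fun _ : Fin 0 => T) := by
        rw [phiPart, if_pos rfl, if_neg (by omega), sub_zero]
      rw [this]
      change (susp k A).symm (f _) = (susp k A).symm (f _)
      congr 2
      exact Subsingleton.elim _ _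
    | succ n =>
      have : phiPart lam T 0 (n + 1) = 0 := by
        rw [phiPart, if_neg (by omega), if_neg (by omega), sub_zero]
      rw [this, DirectSum.lof_eq_of k ℕ (CAlg k A),
        DirectSum.of_eq_of_ne _ _ _ (Nat.succ_ne_zero n).symm, map_zero, map_zero]
      exact map_zero (DirectSum.lof k ℕ (CRBO k A) (n + 1))
  rw [this]
  rfl

theorem comparison_differential (lam : k) (mul : A →ₗ[k] A →ₗ[k] A) (T : A →ₗ[k] A)
    (x : CRBA k A) :
    comparison k A (-algDiff mul x.1, totalPhi lam T x.1 + opDiff lam mul T x.2) =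
      -rbaTotalDiff lam mul T T mul mul (comparison k A x) := by
  have h1 : ∀ n (f : Coch k A A n), rbaDiff lam mul T T mul mul n (inclAlg k A A n f) =
      inclAlg k A A (n + 1) (hochDiff mul mul mul n f) - inclRBO k A A n (Phi lam T T n f) := by
    intro n f
    cases n with
    | zero => exact Prod.ext (sub_zero _).symm (zero_sub _).symm
    | succ n =>
      refine Prod.ext (sub_zero _).symm ?_
      change -(rboDiff lam mul T T mul mul n 0) - Phi lam T T (n + 1) f =
        0 - Phi lam T T (n + 1) f
      rw [map_zero, neg_zero]
  have h2 : ∀ n (g : Coch k A A n), rbaDiff lam mul T T mul mul (n + 1) (inclRBO k A A n g) =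
      -inclRBO k A A (n + 1) (rboDiff lam mul T T mul mul n g) := by
    intro n g
    refine Prod.ext ?_ ?_
    · change hochDiff mul mul mul (n + 1) 0 = -0
      rw [map_zero, neg_zero]
    · change -(rboDiff lam mul T T mul mul n g) - Phi lam T T (n + 1) 0 = _
      rw [map_zero, sub_zero]
      rfl
  let D : CRBA k A →ₗ[k] CRBA k A := (-(algDiff mul ∘ₗ LinearMap.fst k _ _)).prod
    (totalPhi lam T ∘ₗ LinearMap.fst k _ _ + opDiff lam mul T ∘ₗ LinearMap.snd k _ _)
  have : comparison k A ∘ₗ D = -(rbaTotalDiff lam mul T T mul mul ∘ₗ comparison k A) := by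
    refine LinearMap.prod_ext ?_ ?_ <;>
      refine DirectSum.linearMap_ext k fun n => LinearMap.ext fun f => ?_
    · change comparison k A (-algDiff mul (DirectSum.lof k ℕ (CAlg k A) n f),
        totalPhi lam T (DirectSum.lof k ℕ (CAlg k A) n f) + opDiff lam mul T 0) =
        -rbaTotalDiff lam mul T T mul mul (comparison k A (DirectSum.lof k ℕ (CAlg k A) n f, 0))
      rw [map_zero, add_zero, algDiff, totalPhi, DirectSum.toModule_lof, DirectSum.toModule_lof,
        comparison_inl, rbaTotalDiff, DirectSum.toModule_lof]
      simp only [LinearMap.comp_apply]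
      rw [h1, map_sub, ← Prod.fst_add_snd (-_, _), map_add]
      dsimp only
      rw [comparison_inr, ← map_neg, comparison_inl, map_neg, map_neg, map_neg, tilde_untilde,
        hat_unhat]
      abel
    · change comparison k A (-algDiff mul 0,
        totalPhi lam T 0 + opDiff lam mul T (DirectSum.lof k ℕ (CRBO k A) n f)) =
        -rbaTotalDiff lam mul T T mul mul (comparison k A (0, DirectSum.lof k ℕ (CRBO k A) n f))
      rw [map_zero, map_zero, neg_zero, zero_add, opDiff, DirectSum.toModule_lof,
        comparison_inr, rbaTotalDiff, DirectSum.toModule_lof]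
      simp only [LinearMap.comp_apply]
      rw [h2, comparison_inr, map_neg, neg_neg, hat_unhat]
  exact LinearMap.congr_fun this x

/-! ### The twisted differential -/

/-- The count of equal summands and their signs cancel the coefficient of the Maurer-Cartan or
twisting formula exactly; only here is division by factorials used. -/
theorem scalar_cancel [CharZero k] {D : Type*} [AddCommGroup D] [Module k D] (r e : ℕ) (z z' : ℤ)
    (h : Even (z + z' - e)) (x : D) :
    ((r ! : k)⁻¹ * (-1) ^ e) • z.negOnePow • r ! • z'.negOnePow • x = x := by
  have hr : (r ! : k) ≠ 0 := by exact_mod_cast Nat.factorial_ne_zero r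
  rw [smul_comm z.negOnePow, smul_smul z.negOnePow, ← Int.negOnePow_add,
    negOnePow_smul (k := k) h, ← Nat.cast_smul_eq_nsmul k, smul_smul, smul_smul]
  have : (-1 : k) ^ e * (-1) ^ e = 1 := by rw [← mul_pow]; simp
  rw [show (r ! : k)⁻¹ * (-1) ^ e * r ! * (-1) ^ e =
    ((r ! : k)⁻¹ * r !) * ((-1) ^ e * (-1) ^ e) by ring, this, inv_mul_cancel₀ hr, one_mul,
    one_smul]

/-! ### Terms of the Maurer-Cartan equation -/

theorem mcElement_fst (mul : A →ₗ[k] A →ₗ[k] A) (T : A →ₗ[k] A) :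
    (mcElement mul T).1 = DirectSum.lof k ℕ (CAlg k A) 2 (mcAlg mul) := rfl

theorem mcElement_snd (mul : A →ₗ[k] A →ₗ[k] A) (T : A →ₗ[k] A) :
    (mcElement mul T).2 = DirectSum.lof k ℕ (CRBO k A) (tauElt T).1 (tauElt T).2 := rfl

theorem half_aux (m : ℕ) : (m + 1 + 1) * (m + 1) / 2 = m + 1 + (m + 1) * m / 2 := by
  rw [show (m + 1 + 1) * (m + 1) = (m + 1) * m + 2 * (m + 1) by ring,
    Nat.add_mul_div_left _ _ (by norm_num)]
  ring

theorem mcTerm_zero (lam : k) (mul : A →ₗ[k] A →ₗ[k] A) (T : A →ₗ[k] A) :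
    mcTerm (k := k) (op lam) (mcElement mul T) 0 = (0, totalPhiPart lam T 0 (mcElement mul T).1) := by
  rw [totalPhiPart_zero]
  have : op lam (0 + 1) (fun _ => mcElement mul T) = (0, DirectSum.lof k ℕ (CRBO k A) 0
    (desuspOut 0 ((mcElement mul T).1 0))) := rfl
  rw [mcTerm, this]
  simp

/-- Each of the `m + 2` positions of the product contributes the same `(m + 1)!` equal terms, `(m +
2)!` in all. The bracket of `m` with itself is the Hochschild differential of `μ`, which vanishes by
associativity. -/
theorem mcTerm_succ [CharZero k] (lam : k) (mul : A →ₗ[k] A →ₗ[k] A) (T : A →ₗ[k] A)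
    (assoc : ∀ a b c : A, mul (mul a b) c = mul a (mul b c)) (m : ℕ) :
    mcTerm (k := k) (op lam) (mcElement mul T) (m + 1) =
      (0, totalPhiPart lam T (m + 1) (mcElement mul T).1) := by
  classical
  have hg : gerst (mcElement mul T).1 (mcElement mul T).1 = 0 := by
    rw [mcElement_fst, gerst_mcAlg, DirectSum.toModule_lof]
    have : hochDiff mul mul mul 2 (tilde 2 (mcAlg mul)) = 0 := ext_trunc fun u => by
      have hm : ∀ u : ℕ → A, tilde 2 (mcAlg mul) (trunc 2 u) = mul (u 0) (u 1) := fun u => rfl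
      rw [hochDiff_trunc, Finset.sum_range_succ, Finset.sum_range_one]
      simp only [hm, seqContract]
      simp [assoc, pow_succ]
    rw [LinearMap.comp_apply, LinearMap.comp_apply, LinearMap.comp_apply, this, map_zero, map_zero]
  have hop : op lam (m + 1 + 1) (fun _ => mcElement mul T) = (0, ∑ j,
      opInner lam (fun _ : Fin (m + 2) => mcElement mul T) j) := by
    rw [op_eq, hg, ite_self]
  have hin : ∀ j, opInner lam (fun _ : Fin (m + 2) => mcElement mul T) j =
      opFam lam (mcAlg mul) (fun _ : Fin (m + 1) => tauElt T) := by
    intro j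
    rw [opInner_of_tau lam T _ j fun _ => rfl, mcElement_fst, sum_support_lof (fun n f =>
      ((n : ℤ) * j).negOnePow • opFam lam f (fun _ : Fin (m + 1) => tauElt T)),
      Int.negOnePow_even _ ⟨(j : ℤ), by push_cast; ring⟩, one_smul]
    intro h
    rw [h, opFam_zero, smul_zero]
  rw [mcTerm, hop, Finset.sum_congr rfl fun j _ => hin j, Finset.sum_const, Finset.card_univ,
    Fintype.card_fin, opFam_tau, smul_smul (m + 2), ← Nat.factorial_succ, Prod.smul_mk, smul_zero]
  refine Prod.ext rfl ?_
  have := scalar_cancel (k := k) (m + 1 + 1) ((m + 1 + 1) * (m + 1) / 2) 0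
    (((m : ℤ) + 1) * (1 - ((2 : ℕ) : ℤ)) - (((m + 1) * m / 2 : ℕ) : ℤ))
    ⟨-(m + 1) - (((m + 1) * m / 2 : ℕ) : ℤ), by rw [half_aux]; push_cast; ring⟩
    (DirectSum.lof k ℕ (CRBO k A) 2 (unhat 2 (phiPart lam T (m + 1) 2 (tilde 2 (mcAlg mul)))))
  rw [Int.negOnePow_zero, one_smul] at this
  refine this.trans ?_
  rw [mcElement_fst, totalPhiPart, DirectSum.toModule_lof]
  rfl

/-! ### Finiteness of the twisted operations, and the Maurer-Cartan equation -/

open Classical in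
theorem exists_bound {n : ℕ} (x : Fin n → CRBA k A) :
    ∃ b, ∀ j, ∀ i ∈ DFinsupp.support (x j).1, i ≤ b :=
  ⟨Finset.univ.sup fun j => (DFinsupp.support (x j).1).sup id, fun j _ hi =>
    (Finset.le_sup (f := id) hi).trans
      (Finset.le_sup (f := fun j => (DFinsupp.support (x j).1).sup id) (Finset.mem_univ j))⟩

theorem support_mcElement (mul : A →ₗ[k] A →ₗ[k] A) (T : A →ₗ[k] A) [∀ n (f : CAlg k A n),
  Decidable (f ≠ 0)]
    {n : ℕ} (hn : n ∈ DFinsupp.support (mcElement mul T).1) : n = 2 := by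
  by_contra h
  rw [DFinsupp.mem_support_iff, mcElement_fst, DirectSum.lof_eq_of,
    DirectSum.of_eq_of_ne _ _ _ h] at hn
  exact hn rfl

open Classical in
theorem twistTerm_eq_zero (lam : k) (mul : A →ₗ[k] A →ₗ[k] A) (T : A →ₗ[k] A) {n : ℕ}
    (x : Fin n → CRBA k A) {b : ℕ} (hb : ∀ j, ∀ i ∈ DFinsupp.support (x j).1, i ≤ b) {i : ℕ}
    (hi : b + 3 < i) : twistTerm (k := k) (op lam) (mcElement mul T) n x i = 0 := by
  -- `b + 2` bounds the arities of both kinds of arguments: `2` for `α` and `b` for the `x_j`.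
  rw [twistTerm, op_eq_zero lam _ (b + 2) _ (by omega) (by omega), smul_zero]
  intro j
  refine Fin.addCases (fun j => ?_) (fun j => ?_) j
  · intro c hc
    rw [Fin.append_left] at hc
    have := support_mcElement mul T hc
    omega
  · intro c hc
    rw [Fin.append_right] at hc
    have := hb j c hc
    omega

theorem twistTerm_finite (lam : k) (mul : A →ₗ[k] A →ₗ[k] A) (T : A →ₗ[k] A) (n : ℕ)
    (x : Fin n → CRBA k A) :
    (Function.support (twistTerm (k := k) (op lam) (mcElement mul T) n x)).Finite := by
  classical
  obtain ⟨b, hb⟩ := exists_bound x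
  refine (Finset.range (b + 4)).finite_toSet.subset fun i hi => ?_
  by_contra h
  exact hi (twistTerm_eq_zero lam mul T x hb (by
    rw [Finset.mem_coe, Finset.mem_range] at h
    omega))

/-- `Φ μ (a, b) = T(a) T(b) - T(a T(b) + T(a) b + lam a b)`, the defect in the Rota-Baxter identity.
-/
theorem totalPhi_mcAlg {lam : k} {mul : A →ₗ[k] A →ₗ[k] A} {T : A →ₗ[k] A}
    (hA : IsRotaBaxterAlgebra lam mul T) : totalPhi lam T (mcElement mul T).1 = 0 := by
  rw [mcElement_fst, totalPhi, DirectSum.toModule_lof]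
  have : Phi lam T T 2 (tilde 2 (mcAlg mul)) = 0 := ext_trunc fun u => by
    have hm : ∀ u : ℕ → A, tilde 2 (mcAlg mul) (trunc 2 u) = mul (u 0) (u 1) := fun u => rfl
    rw [Phi_trunc, Finset.sum_range_succ, Finset.sum_range_one]
    simp only [hm, stair]
    simp [hA.rotaBaxter]
    abel
  rw [LinearMap.comp_apply, LinearMap.comp_apply, LinearMap.comp_apply, this, map_zero, map_zero]

theorem isMaurerCartan [CharZero k] {lam : k} {mul : A →ₗ[k] A →ₗ[k] A} {T : A →ₗ[k] A}
    (hA : IsRotaBaxterAlgebra lam mul T) : IsMaurerCartan lam (mcElement mul T) := by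
  classical
  have hterm : ∀ n, mcTerm (k := k) (op lam) (mcElement mul T) n =
      (0, totalPhiPart lam T n (mcElement mul T).1) := fun n => by
    cases n with
    | zero => exact mcTerm_zero lam mul T
    | succ n => exact mcTerm_succ lam mul T hA.assoc n
  have hsupp : Function.support (mcTerm (k := k) (op lam) (mcElement mul T)) ⊆
      Finset.range 3 := fun n hn => by
    by_contra h
    rw [Finset.mem_coe, Finset.mem_range, not_lt] at h
    apply hn
    rw [hterm, mcElement_fst, totalPhiPart, DirectSum.toModule_lof, phiPart, if_neg (by omega),
      if_neg (by omega), sub_zero]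
    rw [LinearMap.comp_apply, LinearMap.comp_apply, LinearMap.comp_apply, LinearMap.zero_apply,
      map_zero, map_zero, Prod.mk_zero_zero]
  refine ⟨⟨fun n hn => ?_, fun n hn => ?_⟩, (Finset.range 3).finite_toSet.subset hsupp, ?_⟩
  · rw [mcElement_fst, DirectSum.lof_eq_of, DirectSum.of_eq_of_ne _ _ _ (by rintro rfl; exact hn rfl)]
  · rw [mcElement_snd, DirectSum.lof_eq_of, DirectSum.of_eq_of_ne _ _ _ (by rintro rfl; exact hn rfl)]
  -- The terms are the pieces of `Φ μ`, so their sum is `Φ μ = 0`.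
  · rw [finsum_eq_sum_of_support_subset _ hsupp, Finset.sum_congr rfl fun n _ => hterm n]
    have h := sum_totalPhiPart lam T (mcElement mul T).1 (b := 3)
      fun n hn => by rw [support_mcElement mul T hn]; norm_num
    rw [totalPhi_mcAlg hA] at h
    refine Prod.ext ?_ ?_
    · rw [Prod.fst_sum]
      simp
    · rw [Prod.snd_sum]
      exact h

/-! ### Computation of the twisted differential -/

theorem twistTerm_one_zero (lam : k) (mul : A →ₗ[k] A →ₗ[k] A) (T : A →ₗ[k] A) (x : CRBA k A) :
    twistTerm (k := k) (op lam) (mcElement mul T) 1 (fun _ => x) 0 =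
      (0, totalPhiPart lam T 0 x.1) := by
  rw [totalPhiPart_zero]
  have : op lam (0 + 1) (Fin.append (fun _ : Fin 0 => mcElement mul T) (fun _ : Fin 1 => x)) =
    (0, DirectSum.lof k ℕ (CRBO k A) 0 (desuspOut 0 (x.1 0))) := rfl
  rw [twistTerm, this]
  simp

-- There are two sources in `𝔠_RBO(A)`: either the algebra element is taken from `x` and all copies
-- of `α` give `τ`, or one of the `m + 1` copies of `α` gives `m` and `x` gives `g`.
open Classical in
theorem twistTerm_one_succ [CharZero k] (lam : k) (mul : A →ₗ[k] A →ₗ[k] A) (T : A →ₗ[k] A)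
    (x : CRBA k A) (m : ℕ) :
    twistTerm (k := k) (op lam) (mcElement mul T) 1 (fun _ => x) (m + 1) =
      (if m = 0 then -algDiff mul x.1 else 0, totalPhiPart lam T (m + 1) x.1 +
        ((((m + 1)! : k)⁻¹ * (-1) ^ ((m + 1) + (m + 1) * m / 2)) * ((m + 1 : ℕ) : k)) •
          ∑ c ∈ DFinsupp.support x.2, opFam lam (mcAlg mul)
            (Function.update (fun _ : Fin (m + 1) => tauElt T) (Fin.last m) ⟨c, x.2 c⟩)) := by
  set y : Fin (m + 2) → CRBA k A := Fin.snoc (fun _ : Fin (m + 1) => mcElement mul T) x with hy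
  have happ : Fin.append (fun _ : Fin (m + 1) => mcElement mul T) (fun _ : Fin 1 => x) = y :=
    Fin.append_right_eq_snoc _ _
  have hlast : y (Fin.last (m + 1)) = x := Fin.snoc_last _ _
  have hcast : ∀ j : Fin (m + 1), y j.castSucc = mcElement mul T := fun j => Fin.snoc_castSucc _ _ j
  have hne : ∀ j : Fin (m + 2), j ≠ Fin.last (m + 1) → y j = mcElement mul T := fun j hj => by
    rw [← Fin.castSucc_castPred j hj, hcast]
  rw [twistTerm, happ]
  change _ • op lam (m + 2) y = _
  rw [op_eq, mul_one, Nat.add_sub_cancel]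
  set s : k := ((m + 1)! : k)⁻¹ * (-1) ^ ((m + 1) + (m + 1) * m / 2) with hs
  refine Prod.ext ?_ ?_
  · change s • (if m = 0 then gerst (y 0).1 (y 1).1 else 0) = if m = 0 then -algDiff mul x.1 else 0
    split_ifs with hm
    · subst hm
      rw [show y 0 = mcElement mul T from hcast 0, show y 1 = x from hlast, mcElement_fst,
        gerst_mcAlg, show s = -1 by rw [hs]; norm_num]
      exact neg_one_smul k (algDiff mul x.1)
    · exact smul_zero _
  · change s • ∑ j, opInner lam y j = _
    rw [Fin.sum_univ_castSucc, smul_add, add_comm]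
    refine congrArg₂ (· + ·) ?_ ?_
    · rw [opInner_of_tau lam T y (Fin.last (m + 1)) fun i => by
        rw [Fin.succAbove_last, hcast, mcElement_snd], hlast, totalPhiPart, toModule_eq_sum,
        Finset.smul_sum]
      refine Finset.sum_congr rfl fun n _ => ?_
      rw [opFam_tau]
      exact scalar_cancel (k := k) (m + 1) _ _ _
        ⟨-(((m + 1) * m / 2 : ℕ) : ℤ), by rw [Fin.val_last]; push_cast; ring⟩ _
    · rw [Finset.sum_congr rfl fun j _ => opInner_of_mcAlg lam mul T y j (by rw [hcast]; rfl)
        fun i hi => by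
          rw [hne _ (Fin.succAbove_ne_last (Fin.castSucc_lt_last j).ne hi), mcElement_snd], hlast,
        Finset.sum_const, Finset.card_univ, Fintype.card_fin, ← Nat.cast_smul_eq_nsmul k, smul_smul]

theorem twist_one [CharZero k] (lam : k) (mul : A →ₗ[k] A →ₗ[k] A) (T : A →ₗ[k] A)
    (x : CRBA k A) :
    twist k (op lam) (mcElement mul T) 1 (fun _ => x) =
      (-algDiff mul x.1, totalPhi lam T x.1 + opDiff lam mul T x.2) := by
  classical
  obtain ⟨b, hb⟩ := exists_bound (fun _ : Fin 1 => x)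
  have hsupp : Function.support (twistTerm (k := k) (op lam) (mcElement mul T) 1 fun _ => x) ⊆
      Finset.range (b + 4) := fun i hi => by
    by_contra h
    exact hi (twistTerm_eq_zero lam mul T _ hb (by
    rw [Finset.mem_coe, Finset.mem_range] at h
    omega))
  -- The product has only two arguments, so at most two insertions into it are possible.
  have hvanish : ∀ m, ∑ c ∈ DFinsupp.support x.2, opFam lam (mcAlg mul)
      (Function.update (fun _ : Fin (m + 2 + 1) => tauElt T) (Fin.last (m + 2)) ⟨c, x.2 c⟩) = 0 :=
    fun m => Finset.sum_eq_zero fun c _ => opFam_eq_zero_of_lt lam (by omega) _ _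
  have hd : -(∑ c ∈ DFinsupp.support x.2, opFam lam (mcAlg mul)
      (Function.update (fun _ : Fin 1 => tauElt T) (Fin.last 0) ⟨c, x.2 c⟩)) -
      ∑ c ∈ DFinsupp.support x.2, opFam lam (mcAlg mul)
      (Function.update (fun _ : Fin 2 => tauElt T) (Fin.last 1) ⟨c, x.2 c⟩) =
      opDiff lam mul T x.2 := by
    rw [opDiff, toModule_eq_sum, sub_eq_add_neg, ← neg_add, ← Finset.sum_add_distrib,
      ← Finset.sum_neg_distrib]
    refine Finset.sum_congr rfl fun c _ => ?_
    rw [opFam_mcAlg, neg_neg]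
    rfl
  rw [twist, finsum_eq_sum_of_support_subset _ hsupp, Finset.sum_range_succ',
    Finset.sum_congr rfl fun m _ => twistTerm_one_succ lam mul T x m, twistTerm_one_zero]
  refine Prod.ext ?_ ?_
  · rw [Prod.fst_add, Prod.fst_sum]
    simp
  · rw [Prod.snd_add, Prod.snd_sum]
    dsimp only
    rw [Finset.sum_add_distrib, add_right_comm,
      ← Finset.sum_range_succ' (fun r => totalPhiPart lam T r x.1),
      sum_totalPhiPart lam T x.1 fun n hn => by have := hb 0 n hn; omega, ← hd]
    congr 1
    rw [Finset.sum_range_succ', Finset.sum_range_succ']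
    rw [Finset.sum_eq_zero fun m _ => by rw [hvanish, smul_zero], zero_add]
    -- One and two copies of `α` both have total coefficient `-1`, the latter as `(1/2!) · (-1)^3 ·
    -- 2`; this turns `-∂` of `opFam_mcAlg` into `∂`.
    have h1 : (((0 + 1 + 1)! : k)⁻¹ * (-1) ^ ((0 + 1 + 1) + (0 + 1 + 1) * (0 + 1) / 2)) *
        ((0 + 1 + 1 : ℕ) : k) = -1 := by
      norm_num [Nat.factorial]
    have h0 : (((0 + 1)! : k)⁻¹ * (-1) ^ ((0 + 1) + (0 + 1) * 0 / 2)) *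
        ((0 + 1 : ℕ) : k) = -1 := by
      norm_num [Nat.factorial]
    have hneg : ∀ z : ⨁ n, CRBO k A n, (-1 : k) • z = -z := fun z => neg_one_smul k z
    rw [h0, h1, hneg, hneg, add_comm, ← sub_eq_add_neg]

theorem comparison_twist_one [CharZero k] (lam : k) (mul : A →ₗ[k] A →ₗ[k] A) (T : A →ₗ[k] A)
    (x : CRBA k A) :
    comparison k A (twist k (op lam) (mcElement mul T) 1 (fun _ => x)) =
      -rbaTotalDiff lam mul T T mul mul (comparison k A x) := by
  rw [twist_one, comparison_differential]

theorem rbaTotalDiff_rbaTotalDiff {lam : k} {mul : A →ₗ[k] A →ₗ[k] A} {T : A →ₗ[k] A}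
    (hA : IsRotaBaxterAlgebra lam mul T) (c : ⨁ n, CochRBA k A A n) :
    rbaTotalDiff lam mul T T mul mul (rbaTotalDiff lam mul T T mul mul c) = 0 := by
  have : rbaTotalDiff lam mul T T mul mul ∘ₗ rbaTotalDiff lam mul T T mul mul = 0 := by
    refine DirectSum.linearMap_ext k fun n => LinearMap.ext fun c => ?_
    rw [LinearMap.comp_apply, LinearMap.comp_apply, rbaTotalDiff, DirectSum.toModule_lof,
      LinearMap.comp_apply, DirectSum.toModule_lof, LinearMap.comp_apply,
        ← LinearMap.comp_apply (rbaDiff lam mul T T mul mul (n + 1)),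
      hA.rbaDiff_comp_rbaDiff, LinearMap.zero_apply, map_zero]
    rfl
  exact LinearMap.congr_fun this c

/-- Transported from `d² = 0` along the bijective comparison map; the general theory of twisting is
not needed. -/
theorem twist_one_twist_one [CharZero k] {lam : k} {mul : A →ₗ[k] A →ₗ[k] A} {T : A →ₗ[k] A}
    (hA : IsRotaBaxterAlgebra lam mul T) (x : CRBA k A) :
    twist k (op lam) (mcElement mul T) 1 (fun _ =>
      twist k (op lam) (mcElement mul T) 1 (fun _ => x)) = 0 := by
  apply comparison_bijective.1
  rw [comparison_twist_one, comparison_twist_one, map_neg, rbaTotalDiff_rbaTotalDiff hA, neg_zero,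
    neg_zero, map_zero]

end Graded

end RotaBaxter

end

theorem mainTheorem4 {k : Type*} [Field k] [CharZero k] {A : Type*} [AddCommGroup A] [Module k A]
    (lam : k) (mul : A →ₗ[k] A →ₗ[k] A) (T : A →ₗ[k] A)
    (hA : RotaBaxter.IsRotaBaxterAlgebra lam mul T) :
    -- `α` is a Maurer-Cartan element, and all sums that define the twisted operations are finite
    RotaBaxter.IsMaurerCartan lam (RotaBaxter.mcElement mul T) ∧
    (∀ n : ℕ, 1 ≤ n → ∀ x : Fin n → RotaBaxter.CRBA k A,
      (Function.support (RotaBaxter.twistTerm (k := k) (RotaBaxter.op lam)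
        (RotaBaxter.mcElement mul T) n x)).Finite) ∧
    -- the Hochschild cochains and the operator cochains are complexes, `Φ` is a chain map, and
    -- the negative shift of its mapping cone is a complex
    (∀ n : ℕ, RotaBaxter.hochDiff mul mul mul (n + 1) ∘ₗ RotaBaxter.hochDiff mul mul mul n = 0) ∧
    (∀ n : ℕ, RotaBaxter.rboDiff lam mul T T mul mul (n + 1) ∘ₗ
      RotaBaxter.rboDiff lam mul T T mul mul n = 0) ∧
    (∀ n : ℕ, RotaBaxter.Phi lam T T (n + 1) ∘ₗ RotaBaxter.hochDiff mul mul mul n =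
      RotaBaxter.rboDiff lam mul T T mul mul n ∘ₗ RotaBaxter.Phi lam T T n) ∧
    (∀ n : ℕ, RotaBaxter.rbaDiff lam mul T T mul mul (n + 1) ∘ₗ
      RotaBaxter.rbaDiff lam mul T T mul mul n = 0) ∧
    -- the twisted operation `l_1^α` is a differential
    (∀ x : RotaBaxter.CRBA k A,
      RotaBaxter.twist k (RotaBaxter.op lam) (RotaBaxter.mcElement mul T) 1
        (fun _ => RotaBaxter.twist k (RotaBaxter.op lam) (RotaBaxter.mcElement mul T) 1
          (fun _ => x)) = 0) ∧
    -- the comparison map is an isomorphism of graded spaces from `𝔠_RBA(A)` to `s C_RBA(A)`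
    -- (where `s C^n` has homological degree `1 - n`)
    Function.Bijective (RotaBaxter.comparison k A) ∧
    (∀ (n : ℕ) (x : RotaBaxter.CRBA k A), x ∈ RotaBaxter.homogeneous k A (1 - (n : ℤ)) ↔
      RotaBaxter.comparison k A x ∈
        LinearMap.range (DirectSum.lof k ℕ (RotaBaxter.CochRBA k A A) n)) ∧
    -- and takes `l_1^α` to the differential `s c ↦ - s d(c)` of `s C_RBA(A)`
    (∀ x : RotaBaxter.CRBA k A,
      RotaBaxter.comparison k A
          (RotaBaxter.twist k (RotaBaxter.op lam) (RotaBaxter.mcElement mul T) 1 (fun _ => x)) =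
        -RotaBaxter.rbaTotalDiff lam mul T T mul mul (RotaBaxter.comparison k A x)) := by
  exact ⟨RotaBaxter.isMaurerCartan hA,
    fun n _ x => RotaBaxter.twistTerm_finite lam mul T n x,
    RotaBaxter.hochDiff_comp_hochDiff mul mul mul hA.assoc hA.assoc hA.assoc hA.assoc,
    hA.rboDiff_comp_rboDiff, hA.Phi_comp_hochDiff, hA.rbaDiff_comp_rbaDiff,
    RotaBaxter.twist_one_twist_one hA, RotaBaxter.comparison_bijective,
    RotaBaxter.mem_homogeneous_iff, RotaBaxter.comparison_twist_one lam mul T⟩
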